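/- **Setting.** Let $A:\mathbb R^p\to\mathbb R^{n\times n}$, $B:\mathbb R^p\to\mathbb R^{n\times m}$ be affine, let $Q,R\succ0$ be symmetric, and let $\|\cdot\|$ be the Euclidean norm. Write $A(\theta)x+B(\theta)u=\delta(x,u)+D(x,u)\theta$ with $\delta(x,u)=A(0)x+B(0)u$ and $D(x,u)\in\mathbb R^{n\times p}$ linear in $(x,u)$. A pair $(M,N)$ is stabilizable if $M+NK$ is Schur stable (all eigenvalues of modulus $<1$) for some $K$. If $(A(\theta),B(\theta))$ is stabilizable, let $P(\theta)\succ0$ be the positive definite solution of $$P=A^\top PA-A^\top PB(R+B^\top PB)^{-1}B^\top PA+Q,\qquad A=A(\theta),\ B=B(\theta),$$ and put $K(\theta)=-(R+B^\top PB)^{-1}B^\top PA$, $V(x,\theta)=x^\top P(\theta)x$. For a compact convex $\Theta\subset\mathbb R^p$, a step size $\mu>0$, parameters $\theta_k\in\Theta$, disturbances $w_k\in\mathbb R^n$, an initial state $x_0$ and an initial estimate $\hat\theta_0\in\Theta$, the closed loop is, for $k\in\mathbb N$, $$x_{k+1}=A(\theta_k)x_k+B(\theta_k)u_k+w_k,\qquad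 u_k=K(\hat\theta_k)x_k,$$ $$\hat\theta_{k+1}=\Pi_\Theta\big[\hat\theta_k+\mu D(x_k,u_k)^\top\big(x_{k+1}-A(\hat\theta_k)x_k-B(\hat\theta_k)u_k\big)\big],$$ where $\Pi_\Theta$ is the Euclidean projection onto $\Theta$. Put $\varphi_k=\hat\theta_k-\theta_k$, $\Delta\theta_k=\theta_{k+1}-\theta_k$, $e_k=x_{k+1}-A(\hat\theta_k)x_k-B(\hat\theta_k)u_k-w_k$, and, for $\beta>0$, $\tilde V(x,\varphi,k)=V(x,\varphi+\theta_k)+\frac{\beta}{\mu}\|\varphi\|^2$. **Theorem.** Let $\Theta_0\subset\mathbb R^p$ be a compact set such that $(A(\theta),B(\theta))$ is stabilizable for every $\theta\in\Theta_0$. There is $d_0>0$, depending only on $A,B,Q,R,\Theta_0$, such that for every compact convex $\Theta\subseteq\Theta_0$ of diameter at most $d_0$, and all $\bar W,r\ge0$, there is $\mu_0>0$ such that for every step size $0<\mu\le\mu_0$ there are constants $X,U,\alpha,\beta,\gamma,\tilde\alpha,\tilde\gamma,\tilde\delta,\underline c,\bar c,c_1,c_2,c_3,c_4>0$ with the following properties.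 For every closed-loop trajectory with $\theta_k\in\Theta$ and $\|w_k\|\le\bar W$ for all $k$, $\|x_0\|\le r$ and $\hat\theta_0\in\Theta$: (a) $\|x_k\|\le X$ and $\|u_k\|\le U$ for all $k\in\mathbb N$; (b) for all $k\in\mathbb N$, $V(x_{k+1},\hat\theta_{k+1})-V(x_k,\hat\theta_k)\le-\alpha\|x_k\|^2+\beta\|e_k\|^2+\gamma\|w_k\|^2$, and, with this $\beta$ in $\tilde V$, $$\underline c\,(\|x_k\|^2+\|\varphi_k\|^2)\le\tilde V(x_k,\varphi_k,k)\le\bar c\,(\|x_k\|^2+\|\varphi_k\|^2),$$ $$\tilde V(x_{k+1},\varphi_{k+1},k+1)-\tilde V(x_k,\varphi_k,k)\le-\tilde\alpha\|x_k\|^2+\tilde\gamma\|w_k\|^2+\tilde\delta\|\Delta\theta_k\|;$$ (c) for all $T\in\mathbb N$, $$\sum_{k=0}^T\|x_k\|^2\le c_1\|x_0\|^2+c_2\|\varphi_0\|^2+c_3\sum_{k=0}^T\|w_k\|^2+c_4\sum_{k=0}^T\|\Delta\theta_k\|.$$ In particular the state is finite-gain $\ell^2$-stable with respect to the disturbance when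 $\{\Delta\theta\}\in\ell^1$: for every sequence $\theta_k\in\Theta$ with $\sum_k\|\Delta\theta_k\|<\infty$, every $x_0$ with $\|x_0\|\le r$ and every $\hat\theta_0\in\Theta$ there are $g_1,g_2\ge0$ with $\sum_{k=0}^T\|x_k\|^2\le g_1\sum_{k=0}^T\|w_k\|^2+g_2$ for all $T\in\mathbb N$ and all square-summable $w$ with $\|w_k\|\le\bar W$ for all $k$. -/

import Mathlib

open Matrix

/-- Column vectors with the Euclidean norm. -/
abbrev EVec (n : ℕ) : Type := EuclideanSpace ℝ (Fin n)

/-- A real square matrix is Schur stable if all its complex eigenvalues have modulus `< 1`. -/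
def IsSchurStable {n : ℕ} (M : Matrix (Fin n) (Fin n) ℝ) : Prop :=
  ∀ z ∈ spectrum ℂ (M.map (algebraMap ℝ ℂ)), ‖z‖ < 1

/-- The pair `(M, N)` is (discrete-time) stabilizable: some static state feedback makes the closed
loop Schur stable. -/
def IsStabilizable {n m : ℕ} (M : Matrix (Fin n) (Fin n) ℝ) (N : Matrix (Fin n) (Fin m) ℝ) :
    Prop :=
  ∃ K : Matrix (Fin m) (Fin n) ℝ, IsSchurStable (M + N * K)

/-- `P` solves the discrete-time algebraic Riccati equation of `(M, N)` with weights `Q`, `R`. -/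
def SolvesDARE {n m : ℕ} (M : Matrix (Fin n) (Fin n) ℝ) (N : Matrix (Fin n) (Fin m) ℝ)
    (Q : Matrix (Fin n) (Fin n) ℝ) (R : Matrix (Fin m) (Fin m) ℝ)
    (P : Matrix (Fin n) (Fin n) ℝ) : Prop :=
  P = Mᵀ * P * M - Mᵀ * P * N * (R + Nᵀ * P * N)⁻¹ * Nᵀ * P * M + Q

/-- The positive definite solution of the Riccati equation (an arbitrary matrix if there is no such
solution). -/
noncomputable def dareSolution {n m : ℕ} (M : Matrix (Fin n) (Fin n) ℝ)
    (N : Matrix (Fin n) (Fin m) ℝ) (Q : Matrix (Fin n) (Fin n) ℝ)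
    (R : Matrix (Fin m) (Fin m) ℝ) : Matrix (Fin n) (Fin n) ℝ :=
  Classical.epsilon fun P => P.PosDef ∧ SolvesDARE M N Q R P

/-- The LQR gain `-(R + Nᵀ P N)⁻¹ Nᵀ P M`, `P` the solution of the Riccati equation. -/
noncomputable def lqrGain {n m : ℕ} (M : Matrix (Fin n) (Fin n) ℝ)
    (N : Matrix (Fin n) (Fin m) ℝ) (Q : Matrix (Fin n) (Fin n) ℝ)
    (R : Matrix (Fin m) (Fin m) ℝ) : Matrix (Fin m) (Fin n) ℝ :=
  -((R + Nᵀ * dareSolution M N Q R * N)⁻¹ * Nᵀ * dareSolution M N Q R * M)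

/-- The value `A(ϑ) x + B(ϑ) u`: the noise-free successor state under the parameter `ϑ`. -/
noncomputable def nominalStep {n m p : ℕ} (A : EVec p →ᵃ[ℝ] Matrix (Fin n) (Fin n) ℝ)
    (B : EVec p →ᵃ[ℝ] Matrix (Fin n) (Fin m) ℝ) (ϑ : EVec p) (x : EVec n) (u : EVec m) : EVec n :=
  toEuclideanLin (A ϑ) x + toEuclideanLin (B ϑ) u

/-- The regressor matrix `D(x, u)`, whose `j`-th column is `A'(e_j) x + B'(e_j) u`, where `A'`, `B'`
are the linear parts of the affine maps `A`, `B`. -/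
noncomputable def regressor {n m p : ℕ} (A : EVec p →ᵃ[ℝ] Matrix (Fin n) (Fin n) ℝ)
    (B : EVec p →ᵃ[ℝ] Matrix (Fin n) (Fin m) ℝ) (x : EVec n) (u : EVec m) :
    Matrix (Fin n) (Fin p) ℝ :=
  Matrix.of fun i j =>
    (toEuclideanLin (A.linear (EuclideanSpace.single j 1)) x +
      toEuclideanLin (B.linear (EuclideanSpace.single j 1)) u) i

/-- `D(x, u)` is the matrix for which the dynamics read `δ(x, u) + D(x, u) ϑ`, where
`δ(x, u) = A(0) x + B(0) u`. -/
theorem nominalStep_eq_regressor {n m p : ℕ} (A : EVec p →ᵃ[ℝ] Matrix (Fin n) (Fin n) ℝ)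
    (B : EVec p →ᵃ[ℝ] Matrix (Fin n) (Fin m) ℝ) (ϑ : EVec p) (x : EVec n) (u : EVec m) :
    nominalStep A B ϑ x u = nominalStep A B 0 x u + toEuclideanLin (regressor A B x u) ϑ := by
  have key : toEuclideanLin (regressor A B x u) ϑ =
      toEuclideanLin (A.linear ϑ) x + toEuclideanLin (B.linear ϑ) u := by
    have hϑ : ϑ = ∑ j, ϑ j • EuclideanSpace.single j (1 : ℝ) := by
      ext i
      simp [Finset.sum_apply, Pi.single_apply]
    conv_rhs => rw [hϑ]
    simp only [map_sum, map_smul, LinearMap.sum_apply, LinearMap.smul_apply]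
    rw [← Finset.sum_add_distrib]
    ext i
    simp [regressor, toLpLin_apply, mulVec, dotProduct, mul_comm, mul_add]
  have hA : A ϑ = A.linear ϑ + A 0 := by
    simpa using A.map_vadd 0 ϑ
  have hB : B ϑ = B.linear ϑ + B 0 := by
    simpa using B.map_vadd 0 ϑ
  rw [key, nominalStep, nominalStep, hA, hB]
  simp only [map_add, LinearMap.add_apply]
  abel

/-- `z` is the projection of `y` onto `S`: a point of `S` of minimal distance to `y`. -/
def IsProjection {p : ℕ} (S : Set (EVec p)) (y z : EVec p) : Prop :=
  z ∈ S ∧ ∀ z' ∈ S, ‖z - y‖ ≤ ‖z' - y‖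

/-- The sequences `x` (state), `u` (input), `θhat` (parameter estimate) form a trajectory of the
closed loop of the linear time-varying system with parameters `θ` and disturbances `w`, the
certainty-equivalent LQR with weights `Q`, `R`, and the projected least mean square estimator with
parameter set `Θ` and step size `μ`. -/
structure IsClosedLoop {n m p : ℕ} (A : EVec p →ᵃ[ℝ] Matrix (Fin n) (Fin n) ℝ)
    (B : EVec p →ᵃ[ℝ] Matrix (Fin n) (Fin m) ℝ) (Q : Matrix (Fin n) (Fin n) ℝ)
    (R : Matrix (Fin m) (Fin m) ℝ) (Θ : Set (EVec p)) (μ : ℝ) (θ : ℕ → EVec p) (w : ℕ → EVec n)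
    (x : ℕ → EVec n) (u : ℕ → EVec m) (θhat : ℕ → EVec p) : Prop where
  system : ∀ k, x (k + 1) = nominalStep A B (θ k) (x k) (u k) + w k
  control : ∀ k, u k = toEuclideanLin (lqrGain (A (θhat k)) (B (θhat k)) Q R) (x k)
  init : θhat 0 ∈ Θ
  estimator : ∀ k, IsProjection Θ
    (θhat k + μ • toEuclideanLin (regressor A B (x k) (u k))ᵀ
      (x (k + 1) - nominalStep A B (θhat k) (x k) (u k)))
    (θhat (k + 1))

/-- The LQR Lyapunov function `V(x, ϑ) = xᵀ P(ϑ) x`. -/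
noncomputable def lqrLyapunov {n m p : ℕ} (A : EVec p →ᵃ[ℝ] Matrix (Fin n) (Fin n) ℝ)
    (B : EVec p →ᵃ[ℝ] Matrix (Fin n) (Fin m) ℝ) (Q : Matrix (Fin n) (Fin n) ℝ)
    (R : Matrix (Fin m) (Fin m) ℝ) (x : EVec n) (ϑ : EVec p) : ℝ :=
  x.ofLp ⬝ᵥ (dareSolution (A ϑ) (B ϑ) Q R *ᵥ x.ofLp)

/-- The joint Lyapunov function of state `x` and estimation error `φ` at time `k`:
`V(x, φ + θ_k) + (β / μ) ‖φ‖²`. -/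
noncomputable def jointLyapunov {n m p : ℕ} (A : EVec p →ᵃ[ℝ] Matrix (Fin n) (Fin n) ℝ)
    (B : EVec p →ᵃ[ℝ] Matrix (Fin n) (Fin m) ℝ) (Q : Matrix (Fin n) (Fin n) ℝ)
    (R : Matrix (Fin m) (Fin m) ℝ) (θ : ℕ → EVec p) (β μ : ℝ) (x : EVec n) (φ : EVec p) (k : ℕ) :
    ℝ :=
  lqrLyapunov A B Q R x (φ + θ k) + β / μ * ‖φ‖ ^ 2

/-- Finite-gain `ℓ²`-stability with respect to the disturbance. `traj w x` says that `x` is a state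
trajectory generated by the (admissible) disturbance signal `w`. -/
def IsFiniteGainL2Stable {n : ℕ} (traj : (ℕ → EVec n) → (ℕ → EVec n) → Prop) : Prop :=
  ∃ g₁ g₂ : ℝ, 0 ≤ g₁ ∧ 0 ≤ g₂ ∧ ∀ w x : ℕ → EVec n, traj w x → Summable (fun k => ‖w k‖ ^ 2) →
    ∀ T : ℕ, ∑ k ∈ Finset.range (T + 1), ‖x k‖ ^ 2 ≤
      g₁ * ∑ k ∈ Finset.range (T + 1), ‖w k‖ ^ 2 + g₂

/-!
The value function `V` of the certainty-equivalent LQR remains a Lyapunov function when the estimate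
changes slightly: inflated by `1 + s`, the Riccati solution at `ϑ` satisfies the Riccati inequality
at nearby `ϑ'`, and every such supersolution dominates the Riccati solution at `ϑ'`. Thus `V` loses
`q/2 ‖x‖²` per step up to `β (‖e‖² + ‖w‖²)`, where `e` is the part of the prediction error caused by
the wrong estimate. Over a small parameter set `‖e‖` is small compared to `‖x‖`, which bounds the
state and makes a fixed step size `μ` admissible. A projected gradient step lowers the squared
estimation error by `μ ‖e‖²` up to disturbance and drift, so with the weight `β/μ` it cancels the
term `β ‖e‖²` in the decrease of `V`.
-/

section EuclideanMatrices

open scoped MatrixOrder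

/-- The quadratic form `xᵀ P x` on Euclidean space, which measures costs and Lyapunov functions. -/
def quadForm {ι : Type*} [Fintype ι] (P : Matrix ι ι ℝ) (x : EuclideanSpace ℝ ι) : ℝ :=
  x.ofLp ⬝ᵥ (P *ᵥ x.ofLp)

theorem transpose_eq_of_posSemidef {ι : Type*} {P : Matrix ι ι ℝ} (hP : P.PosSemidef) : Pᵀ = P := by
  simpa [IsHermitian] using hP.isHermitian

theorem posSemidef_conj {ι κ : Type*} [Finite ι] [Fintype κ] {P : Matrix κ κ ℝ} (hP : P.PosSemidef)
    (M : Matrix κ ι ℝ) : (Mᵀ * P * M).PosSemidef := by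
  simpa using hP.conjTranspose_mul_mul_same M

theorem posDef_add_conj {ι κ : Type*} [Fintype ι] [Finite κ] {P : Matrix ι ι ℝ}
    (hP : P.PosSemidef) {R : Matrix κ κ ℝ} (hR : R.PosDef) (N : Matrix ι κ ℝ) :
    (R + Nᵀ * P * N).PosDef :=
  hR.add_posSemidef (posSemidef_conj hP N)

variable {ι κ : Type*} [Fintype ι] [Fintype κ]

theorem quadForm_add_matrix (P P' : Matrix ι ι ℝ) (x : EuclideanSpace ℝ ι) :
    quadForm (P + P') x = quadForm P x + quadForm P' x := by
  simp [quadForm, add_mulVec, dotProduct_add]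

theorem quadForm_sub_matrix (P P' : Matrix ι ι ℝ) (x : EuclideanSpace ℝ ι) :
    quadForm (P - P') x = quadForm P x - quadForm P' x := by
  simp [quadForm, sub_mulVec, dotProduct_sub]

theorem quadForm_smul_matrix (c : ℝ) (P : Matrix ι ι ℝ) (x : EuclideanSpace ℝ ι) :
    quadForm (c • P) x = c * quadForm P x := by
  simp [quadForm, smul_mulVec, dotProduct_smul]

theorem quadForm_one [DecidableEq ι] (x : EuclideanSpace ℝ ι) : quadForm 1 x = ‖x‖ ^ 2 := by
  simp [quadForm, dotProduct, EuclideanSpace.real_norm_sq_eq, ← sq]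

theorem quadForm_eq_inner [DecidableEq ι] (P : Matrix ι ι ℝ) (x : EuclideanSpace ℝ ι) :
    quadForm P x = inner ℝ x (toEuclideanLin P x) := by
  rw [EuclideanSpace.inner_eq_star_dotProduct, star_trivial, dotProduct_comm]
  rfl

theorem posSemidef_iff_quadForm_nonneg {P : Matrix ι ι ℝ} :
    P.PosSemidef ↔ Pᵀ = P ∧ ∀ x, 0 ≤ quadForm P x := by
  refine ⟨fun hP => ⟨transpose_eq_of_posSemidef hP, fun x => ?_⟩, fun h => ?_⟩
  · simpa [quadForm] using hP.dotProduct_mulVec_nonneg x.ofLp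
  · exact .of_dotProduct_mulVec_nonneg (by simpa [IsHermitian] using h.1)
      fun x => by simpa [quadForm] using h.2 (WithLp.toLp 2 x)

theorem quadForm_nonneg {P : Matrix ι ι ℝ} (hP : P.PosSemidef) (x : EuclideanSpace ℝ ι) :
    0 ≤ quadForm P x :=
  (posSemidef_iff_quadForm_nonneg.1 hP).2 x

theorem quadForm_mono {P P' : Matrix ι ι ℝ} (h : P ≤ P') (x : EuclideanSpace ℝ ι) :
    quadForm P x ≤ quadForm P' x := by
  simpa [quadForm_sub_matrix] using quadForm_nonneg (le_iff.1 h) x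

theorem le_of_quadForm_le {P P' : Matrix ι ι ℝ} (hP : P.PosSemidef) (hP' : P'.PosSemidef)
    (h : ∀ x, quadForm P x ≤ quadForm P' x) : P ≤ P' := by
  refine le_iff.2 (posSemidef_iff_quadForm_nonneg.2 ⟨?_, fun x => ?_⟩)
  · rw [transpose_sub, transpose_eq_of_posSemidef hP, transpose_eq_of_posSemidef hP']
  · simpa [quadForm_sub_matrix] using h x

theorem continuous_quadForm_matrix (x : EuclideanSpace ℝ ι) :
    Continuous fun P => quadForm P x := by
  unfold quadForm
  fun_prop

theorem continuous_quadForm (P : Matrix ι ι ℝ) : Continuous (quadForm P) := by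
  unfold quadForm
  fun_prop

theorem isClosed_setOf_posSemidef {ι : Type*} [Finite ι] :
    IsClosed {P : Matrix ι ι ℝ | P.PosSemidef} := by
  have := Fintype.ofFinite ι
  simp only [posSemidef_iff_quadForm_nonneg, Set.ofPred_and, Set.ofPred_forall]
  exact (isClosed_eq (by fun_prop) continuous_id).inter
    (isClosed_iInter fun x => isClosed_le continuous_const (continuous_quadForm_matrix x))

theorem quadForm_add_le {P : Matrix ι ι ℝ} (hP : P.PosSemidef) {s : ℝ} (hs : 0 < s)
    (x y : EuclideanSpace ℝ ι) :
    quadForm P (x + y) ≤ (1 + s) * quadForm P x + (1 + 1 / s) * quadForm P y := by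
  classical
  have key : s * ((1 + s) * quadForm P x + (1 + 1 / s) * quadForm P y - quadForm P (x + y)) =
      quadForm P (s • x - y) := by
    simp only [quadForm_eq_inner, map_add, map_sub, map_smul, inner_add_left, inner_add_right,
      inner_sub_left, inner_sub_right, real_inner_smul_left, real_inner_smul_right]
    field_simp
    ring
  exact sub_nonneg.1 (nonneg_of_mul_nonneg_right (key ▸ quadForm_nonneg hP (s • x - y)) hs)

theorem exists_mul_norm_sq_le_quadForm {P : Matrix ι ι ℝ} (hP : P.PosDef) :
    ∃ q : ℝ, 0 < q ∧ ∀ x, q * ‖x‖ ^ 2 ≤ quadForm P x := by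
  classical
  cases isEmpty_or_nonempty ι
  · exact ⟨1, one_pos, fun x => by simp [Subsingleton.elim x 0, quadForm]⟩
  obtain ⟨q, hq, hqP⟩ := (CFC.exists_pos_algebraMap_le_iff hP.isStrictlyPositive.isSelfAdjoint).2
    fun _ hx => hP.isStrictlyPositive.spectrum_pos hx
  refine ⟨q, hq, fun x => ?_⟩
  simpa [Algebra.algebraMap_eq_smul_one, quadForm_smul_matrix, quadForm_one] using
    quadForm_mono hqP x

open scoped Matrix.Norms.L2Operator in
theorem exists_quadForm_le_mul_norm_sq (P : Matrix ι ι ℝ) :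
    ∃ C : ℝ, 0 < C ∧ ∀ x, quadForm P x ≤ C * ‖x‖ ^ 2 := by
  classical
  refine ⟨‖P‖ + 1, by positivity, fun x => ?_⟩
  have hPx : ‖toEuclideanLin P x‖ ≤ (‖P‖ + 1) * ‖x‖ :=
    (l2_opNorm_mulVec P x).trans (by gcongr; linarith)
  calc quadForm P x = inner ℝ x (toEuclideanLin P x) := quadForm_eq_inner P x
    _ ≤ ‖x‖ * ‖toEuclideanLin P x‖ := real_inner_le_norm _ _
    _ ≤ ‖x‖ * ((‖P‖ + 1) * ‖x‖) := by gcongr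
    _ = (‖P‖ + 1) * ‖x‖ ^ 2 := by ring

variable [DecidableEq ι]

theorem toEuclideanLin_mul_apply {l : Type*} [DecidableEq κ] (M : Matrix l κ ℝ)
    (N : Matrix κ ι ℝ) (x : EuclideanSpace ℝ ι) :
    toEuclideanLin (M * N) x = toEuclideanLin M (toEuclideanLin N x) := by
  rw [toLpLin_mul 2 2 2, LinearMap.comp_apply]

theorem inner_toEuclideanLin_transpose [DecidableEq κ] (M : Matrix κ ι ℝ)
    (x : EuclideanSpace ℝ ι) (y : EuclideanSpace ℝ κ) :
    inner ℝ (toEuclideanLin Mᵀ y) x = inner ℝ y (toEuclideanLin M x) := by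
  rw [← conjTranspose_eq_transpose_of_trivial, toEuclideanLin_conjTranspose_eq_adjoint,
    LinearMap.adjoint_inner_left]

theorem norm_toEuclideanLin_transpose_le [DecidableEq κ] {M : Matrix κ ι ℝ} {C : ℝ} (hC : 0 ≤ C)
    (hM : ∀ x, ‖toEuclideanLin M x‖ ≤ C * ‖x‖) (y : EuclideanSpace ℝ κ) :
    ‖toEuclideanLin Mᵀ y‖ ≤ C * ‖y‖ := by
  set z := toEuclideanLin Mᵀ y
  obtain hz | hz := (norm_nonneg z).eq_or_lt
  · rw [← hz]
    positivity
  refine le_of_mul_le_mul_right ?_ hz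
  calc ‖z‖ * ‖z‖ = inner ℝ y (toEuclideanLin M z) := by
        rw [← inner_toEuclideanLin_transpose, real_inner_self_eq_norm_mul_norm]
    _ ≤ ‖y‖ * ‖toEuclideanLin M z‖ := real_inner_le_norm _ _
    _ ≤ ‖y‖ * (C * ‖z‖) := by
        gcongr
        exact hM z
    _ = C * ‖y‖ * ‖z‖ := by ring

theorem quadForm_toEuclideanLin (P : Matrix κ κ ℝ) (M : Matrix κ ι ℝ) (x : EuclideanSpace ℝ ι) :
    quadForm P (toEuclideanLin M x) = quadForm (Mᵀ * P * M) x := by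
  simp only [quadForm, ofLp_toLpLin, toLin'_apply, ← mulVec_mulVec, dotProduct_mulVec,
    vecMul_transpose]

theorem exists_norm_toEuclideanLin_le {E : Type*} [NormedAddCommGroup E] [NormedSpace ℝ E]
    [FiniteDimensional ℝ E] (T : E →ₗ[ℝ] Matrix κ ι ℝ) :
    ∃ C : ℝ, 0 < C ∧ ∀ v x, ‖toEuclideanLin (T v) x‖ ≤ C * ‖v‖ * ‖x‖ := by
  obtain ⟨C, hC, h⟩ := (LinearMap.toContinuousLinearMap
    (LinearMap.toContinuousLinearMap.toLinearMap ∘ₗ toEuclideanLin.toLinearMap ∘ₗ T)).bound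
  exact ⟨C, hC, fun v x => ContinuousLinearMap.le_of_opNorm_le _ (h v) x⟩

end EuclideanMatrices

section Convergence

open Filter Topology

theorem sum_range_le_of_dissipation {v a : ℕ → ℝ} (hv : ∀ k, 0 ≤ v k)
    (h : ∀ k, v (k + 1) ≤ v k - a k) (T : ℕ) : ∑ k ∈ Finset.range T, a k ≤ v 0 :=
  calc ∑ k ∈ Finset.range T, a k ≤ ∑ k ∈ Finset.range T, (v k - v (k + 1)) :=
        Finset.sum_le_sum fun k _ => by linarith [h k]
    _ = v 0 - v T := Finset.sum_range_sub' v T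
    _ ≤ v 0 := sub_le_self _ (hv T)

theorem tendsto_iterate_zero_of_lyapunov {E : Type*} [SeminormedAddCommGroup E] {F : E → E}
    {V : E → ℝ} {q : ℝ} (hq : 0 < q) (hV : ∀ x, 0 ≤ V x)
    (h : ∀ x, V (F x) ≤ V x - q * ‖x‖ ^ 2) (x : E) :
    Tendsto (fun k => F^[k] x) atTop (𝓝 0) := by
  have hsum : Summable fun k => q * ‖F^[k] x‖ ^ 2 :=
    summable_of_sum_range_le (fun k => by positivity) <|
      sum_range_le_of_dissipation (v := fun k => V (F^[k] x)) (fun k => hV _) fun k => by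
        simpa only [Function.iterate_succ_apply'] using h (F^[k] x)
  have hsq : Tendsto (fun k => ‖F^[k] x‖ ^ 2) atTop (𝓝 0) := by
    simpa [hq.ne'] using hsum.tendsto_atTop_zero.const_mul q⁻¹
  exact tendsto_zero_iff_norm_tendsto_zero.2 (by simpa using hsq.sqrt)

open scoped MatrixOrder in
theorem exists_tendsto_of_antitone_posSemidef {ι : Type*} [Finite ι] {P : ℕ → Matrix ι ι ℝ}
    (hanti : Antitone P) (hP : ∀ k, (P k).PosSemidef) : ∃ L, Tendsto P atTop (𝓝 L) := by
  classical
  have := Fintype.ofFinite ι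
  have hform : ∀ x, ∃ c, Tendsto (fun k => quadForm (P k) x) atTop (𝓝 c) := fun x =>
    ⟨_, tendsto_atTop_ciInf (fun i j hij => quadForm_mono (hanti hij) x)
      ⟨0, by rintro _ ⟨k, rfl⟩; exact quadForm_nonneg (hP k) x⟩⟩
  choose c hc using hform
  let e (i : ι) : EuclideanSpace ℝ ι := EuclideanSpace.single i 1
  have polarization : ∀ k i j, P k i j =
      (quadForm (P k) (e i + e j) - quadForm (P k) (e i) - quadForm (P k) (e j)) / 2 := by
    intro k i j
    have hsymm : P k j i = P k i j := congrFun₂ (transpose_eq_of_posSemidef (hP k)) i j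
    simp [quadForm, e, mulVec_add, hsymm]
    ring
  refine ⟨of fun i j => (c (e i + e j) - c (e i) - c (e j)) / 2,
    tendsto_pi_nhds.2 fun i => tendsto_pi_nhds.2 fun j => ?_⟩
  simp only [polarization, of_apply]
  exact (((hc _).sub (hc _)).sub (hc _)).div_const 2

end Convergence

section Riccati

open Filter Topology
open scoped MatrixOrder

variable {ι κ : Type*} [Fintype ι] [Fintype κ]
  (M : Matrix ι ι ℝ) (N : Matrix ι κ ℝ) (Q : Matrix ι ι ℝ) (R : Matrix κ κ ℝ)

/-- The matrix of the one-step cost of the feedback gain `K` with terminal weight `P`. -/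
def feedbackMap (K : Matrix κ ι ℝ) (P : Matrix ι ι ℝ) : Matrix ι ι ℝ :=
  (M + N * K)ᵀ * P * (M + N * K) + Kᵀ * R * K + Q

variable {M N Q R}

theorem posDef_feedbackMap (hQ : Q.PosDef) (hR : R.PosSemidef) {P : Matrix ι ι ℝ}
    (hP : P.PosSemidef) (K : Matrix κ ι ℝ) : (feedbackMap M N Q R K P).PosDef :=
  .posSemidef_add ((posSemidef_conj hP _).add (posSemidef_conj hR K)) hQ

theorem feedbackMap_mono (K : Matrix κ ι ℝ) {P P' : Matrix ι ι ℝ} (h : P ≤ P') :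
    feedbackMap M N Q R K P ≤ feedbackMap M N Q R K P' := by
  have := posSemidef_conj (le_iff.1 h) (M + N * K)
  rw [Matrix.mul_sub, Matrix.sub_mul] at this
  simpa only [le_iff, feedbackMap, add_sub_add_right_eq_sub] using this

theorem quadForm_feedbackMap [DecidableEq ι] (K : Matrix κ ι ℝ) (P : Matrix ι ι ℝ)
    (x : EuclideanSpace ℝ ι) :
    quadForm (feedbackMap M N Q R K P) x =
      quadForm P (toEuclideanLin (M + N * K) x) + quadForm R (toEuclideanLin K x) +
        quadForm Q x := by
  simp only [feedbackMap, quadForm_add_matrix, quadForm_toEuclideanLin]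

theorem tendsto_iterate_zero_of_feedbackMap_le [DecidableEq ι] (hQ : Q.PosDef) (hR : R.PosSemidef)
    {S : Matrix ι ι ℝ} (hS : S.PosSemidef) {K : Matrix κ ι ℝ} (h : feedbackMap M N Q R K S ≤ S)
    (x : EuclideanSpace ℝ ι) :
    Tendsto (fun k => (toEuclideanLin (M + N * K))^[k] x) atTop (𝓝 0) := by
  obtain ⟨q, hq, hqQ⟩ := exists_mul_norm_sq_le_quadForm hQ
  refine tendsto_iterate_zero_of_lyapunov hq (quadForm_nonneg hS) (fun y => ?_) x
  have hy := quadForm_mono h y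
  rw [quadForm_feedbackMap] at hy
  linarith [hqQ y, quadForm_nonneg hR (toEuclideanLin K y)]

variable [DecidableEq κ] (M N Q R)

/-- The minimizing gain `-(R + Nᵀ P N)⁻¹ Nᵀ P M` of the one-step cost with terminal weight `P`. -/
noncomputable def riccatiGain (P : Matrix ι ι ℝ) : Matrix κ ι ℝ :=
  -((R + Nᵀ * P * N)⁻¹ * Nᵀ * P * M)

/-- The Riccati operator: its value at `P` is the matrix of the minimal one-step cost with terminal
weight `P`, and its fixed points are the solutions of the Riccati equation. -/
noncomputable def riccatiMap (P : Matrix ι ι ℝ) : Matrix ι ι ℝ :=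
  Mᵀ * P * M - Mᵀ * P * N * (R + Nᵀ * P * N)⁻¹ * Nᵀ * P * M + Q

variable {M N Q R}

theorem feedbackMap_eq_riccatiMap_add (hR : R.PosDef) {P : Matrix ι ι ℝ} (hP : P.PosSemidef)
    (K : Matrix κ ι ℝ) :
    feedbackMap M N Q R K P = riccatiMap M N Q R P +
      (K - riccatiGain M N R P)ᵀ * (R + Nᵀ * P * N) * (K - riccatiGain M N R P) := by
  have hG := posDef_add_conj hP hR N
  set G := R + Nᵀ * P * N with hGdef
  set L := riccatiGain M N R P with hL
  have hGL : G * L = -(Nᵀ * P * M) := by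
    rw [hL, riccatiGain, ← hGdef, Matrix.mul_neg, Matrix.mul_assoc, Matrix.mul_assoc,
      mul_nonsing_inv_cancel_left _ _ hG.det_pos.ne'.isUnit, ← Matrix.mul_assoc]
  have hLG : Lᵀ * G = -(Mᵀ * P * N) := by
    rw [← transpose_eq_of_posSemidef hG.posSemidef, ← transpose_mul, hGL]
    simp [transpose_mul, transpose_eq_of_posSemidef hP, Matrix.mul_assoc]
  have hric : riccatiMap M N Q R P = Mᵀ * P * M + Mᵀ * P * N * L + Q := by
    rw [hL, riccatiGain, riccatiMap, ← hGdef]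
    simp [Matrix.mul_assoc, sub_eq_add_neg]
  have hsq : (K - L)ᵀ * G * (K - L) =
      Kᵀ * G * K + Kᵀ * (Nᵀ * P * M) + Mᵀ * P * N * K - Mᵀ * P * N * L := by
    rw [transpose_sub, Matrix.sub_mul, hLG, Matrix.mul_sub, Matrix.sub_mul, Matrix.sub_mul,
      Matrix.mul_assoc Kᵀ G L, hGL]
    simp only [Matrix.mul_neg, Matrix.neg_mul]
    abel
  rw [hric, hsq, feedbackMap, hGdef]
  simp only [transpose_add, transpose_mul, Matrix.add_mul, Matrix.mul_add, Matrix.mul_assoc]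
  abel

theorem feedbackMap_riccatiGain (hR : R.PosDef) {P : Matrix ι ι ℝ} (hP : P.PosSemidef) :
    feedbackMap M N Q R (riccatiGain M N R P) P = riccatiMap M N Q R P := by
  simp [feedbackMap_eq_riccatiMap_add hR hP]

theorem riccatiMap_le_feedbackMap (hR : R.PosDef) {P : Matrix ι ι ℝ} (hP : P.PosSemidef)
    (K : Matrix κ ι ℝ) : riccatiMap M N Q R P ≤ feedbackMap M N Q R K P := by
  rw [feedbackMap_eq_riccatiMap_add hR hP, le_iff, add_sub_cancel_left]
  exact posSemidef_conj (posDef_add_conj hP hR N).posSemidef _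

theorem posDef_riccatiMap (hQ : Q.PosDef) (hR : R.PosDef) {P : Matrix ι ι ℝ}
    (hP : P.PosSemidef) : (riccatiMap M N Q R P).PosDef :=
  feedbackMap_riccatiGain (Q := Q) hR hP ▸ posDef_feedbackMap hQ hR.posSemidef hP _

theorem riccatiMap_mono (hR : R.PosDef) {P P' : Matrix ι ι ℝ} (hP : P.PosSemidef)
    (hP' : P'.PosSemidef) (h : P ≤ P') : riccatiMap M N Q R P ≤ riccatiMap M N Q R P' :=
  calc riccatiMap M N Q R P ≤ feedbackMap M N Q R (riccatiGain M N R P') P :=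
        riccatiMap_le_feedbackMap hR hP _
    _ ≤ feedbackMap M N Q R (riccatiGain M N R P') P' := feedbackMap_mono _ h
    _ = riccatiMap M N Q R P' := feedbackMap_riccatiGain hR hP'

/-- Along the closed loop of `K` the difference of the two quadratic forms increases, while both of
them tend to zero. -/
theorem le_of_le_riccatiMap_of_feedbackMap_le (hQ : Q.PosDef) (hR : R.PosDef)
    {P S : Matrix ι ι ℝ} (hP : P.PosSemidef) (hS : S.PosSemidef) (hPR : P ≤ riccatiMap M N Q R P)
    {K : Matrix κ ι ℝ} (hSK : feedbackMap M N Q R K S ≤ S) : P ≤ S := by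
  classical
  refine le_of_quadForm_le hP hS fun x => sub_nonneg.1 ?_
  set F := toEuclideanLin (M + N * K)
  have step : ∀ y, quadForm (S - P) (F y) ≤ quadForm (S - P) y := fun y => by
    have hPy := quadForm_mono (hPR.trans (riccatiMap_le_feedbackMap hR hP K)) y
    have hSy := quadForm_mono hSK y
    rw [quadForm_feedbackMap] at hPy hSy
    simp only [quadForm_sub_matrix]
    linarith
  have hanti : Antitone fun k => quadForm (S - P) (F^[k] x) :=
    antitone_nat_of_succ_le fun k => by simpa only [Function.iterate_succ_apply'] using step _
  have hlim : Tendsto (fun k => quadForm (S - P) (F^[k] x)) atTop (𝓝 0) :=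
    ((continuous_quadForm (S - P)).tendsto' 0 0 (by simp [quadForm])).comp
      (tendsto_iterate_zero_of_feedbackMap_le hQ hR.posSemidef hS hSK x)
  rw [← quadForm_sub_matrix]
  exact hanti.le_of_tendsto hlim 0

theorem continuousAt_riccatiMap (hR : R.PosDef) {P : Matrix ι ι ℝ} (hP : P.PosSemidef) :
    ContinuousAt (riccatiMap M N Q R) P := by
  have hinv : ContinuousAt (fun P => (R + Nᵀ * P * N)⁻¹) P := by
    refine ContinuousAt.comp (f := fun P => R + Nᵀ * P * N) (continuousAt_matrix_inv _ ?_)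
      (by fun_prop)
    simpa [Ring.inverse_eq_inv'] using
      continuousAt_inv₀ (posDef_add_conj hP hR N).det_pos.ne'
  unfold riccatiMap
  fun_prop

/-- Value iteration: started at a supersolution, the iterates of the Riccati operator decrease to a
fixed point. -/
theorem exists_posDef_riccatiMap_eq (hQ : Q.PosDef) (hR : R.PosDef) {S : Matrix ι ι ℝ}
    (hS : S.PosSemidef) {K : Matrix κ ι ℝ} (hSK : feedbackMap M N Q R K S ≤ S) :
    ∃ P, P.PosDef ∧ riccatiMap M N Q R P = P := by
  let P (k : ℕ) : Matrix ι ι ℝ := (riccatiMap M N Q R)^[k] S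
  have hsucc : ∀ k, P (k + 1) = riccatiMap M N Q R (P k) :=
    fun k => Function.iterate_succ_apply' _ k S
  have hpos : ∀ k, (P k).PosSemidef := fun k => by
    induction k with
    | zero => exact hS
    | succ k ih => exact hsucc k ▸ (posDef_riccatiMap hQ hR ih).posSemidef
  have hanti : Antitone P := antitone_nat_of_succ_le fun k => by
    induction k with
    | zero => exact (riccatiMap_le_feedbackMap hR hS K).trans hSK
    | succ k ih =>
      calc P (k + 2) = riccatiMap M N Q R (P (k + 1)) := hsucc _
        _ ≤ riccatiMap M N Q R (P k) := riccatiMap_mono hR (hpos _) (hpos _) ih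
        _ = P (k + 1) := (hsucc k).symm
  obtain ⟨L, hL⟩ := exists_tendsto_of_antitone_posSemidef hanti hpos
  have hLpos : L.PosSemidef := isClosed_setOf_posSemidef.mem_of_tendsto hL (.of_forall hpos)
  have hfix : riccatiMap M N Q R L = L :=
    tendsto_nhds_unique ((continuousAt_riccatiMap hR hLpos).tendsto.comp hL)
      (((tendsto_add_atTop_iff_nat 1).2 hL).congr hsucc)
  exact ⟨L, hfix ▸ posDef_riccatiMap hQ hR hLpos, hfix⟩

end Riccati

section Stability

open Filter Topology

theorem exists_eventually_norm_pow_le_pow_of_spectralRadius_lt_one {𝒜 : Type*} [NormedRing 𝒜]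
    [NormedAlgebra ℂ 𝒜] [CompleteSpace 𝒜] {a : 𝒜} (ha : spectralRadius ℂ a < 1) :
    ∃ r : ℝ, 0 ≤ r ∧ r < 1 ∧ ∀ᶠ k in atTop, ‖a ^ k‖ ≤ r ^ k := by
  obtain ⟨r, har, hr⟩ := ENNReal.lt_iff_exists_nnreal_btwn.1 ha
  refine ⟨r, r.2, by exact_mod_cast hr, ?_⟩
  have hlim := spectrum.pow_nnnorm_pow_one_div_tendsto_nhds_spectralRadius a
  filter_upwards [hlim.eventually_lt_const har, eventually_gt_atTop 0] with k hk hk0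
  have hroot : (‖a ^ k‖₊ : ENNReal) ≤ (r : ENNReal) ^ k := by
    have := ENNReal.rpow_le_rpow hk.le (Nat.cast_nonneg k)
    rwa [← ENNReal.rpow_mul, one_div_mul_cancel (by positivity), ENNReal.rpow_one,
      ENNReal.rpow_natCast] at this
  exact_mod_cast hroot

open scoped Matrix.Norms.Frobenius

theorem IsSchurStable.exists_eventually_norm_pow_le_pow {n : ℕ} {F : Matrix (Fin n) (Fin n) ℝ}
    (hF : IsSchurStable F) : ∃ r : ℝ, 0 ≤ r ∧ r < 1 ∧ ∀ᶠ k in atTop, ‖F ^ k‖ ≤ r ^ k := by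
  cases isEmpty_or_nonempty (Fin n)
  · exact ⟨0, le_rfl, one_pos, .of_forall fun k => by simp [Subsingleton.elim (F ^ k) 0]⟩
  have : CompleteSpace (Matrix (Fin n) (Fin n) ℂ) := FiniteDimensional.complete ℂ _
  obtain ⟨r, hr0, hr1, hr⟩ := exists_eventually_norm_pow_le_pow_of_spectralRadius_lt_one <|
    spectrum.spectralRadius_lt_of_forall_lt _ (r := 1) fun z hz => mod_cast hF z hz
  refine ⟨r, hr0, hr1, hr.mono fun k hk => ?_⟩
  rwa [← Matrix.map_pow, frobenius_norm_map_eq _ _ (by simp)] at hk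

theorem IsSchurStable.summable_transpose_pow_mul_mul_pow {n : ℕ} {F : Matrix (Fin n) (Fin n) ℝ}
    (hF : IsSchurStable F) (W : Matrix (Fin n) (Fin n) ℝ) :
    Summable fun k => Fᵀ ^ k * W * F ^ k := by
  have : CompleteSpace (Matrix (Fin n) (Fin n) ℝ) := FiniteDimensional.complete ℝ _
  obtain ⟨r, hr0, hr1, hr⟩ := hF.exists_eventually_norm_pow_le_pow
  refine .of_norm_bounded_eventually_nat
    ((summable_geometric_of_lt_one (sq_nonneg r) (pow_lt_one₀ hr0 hr1 two_ne_zero)).mul_left ‖W‖)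
    (hr.mono fun k hk => ?_)
  calc ‖Fᵀ ^ k * W * F ^ k‖ ≤ ‖(F ^ k)ᵀ‖ * ‖W‖ * ‖F ^ k‖ := by
        rw [transpose_pow]
        exact norm_mul₃_le
    _ ≤ r ^ k * ‖W‖ * r ^ k := by
        rw [frobenius_norm_transpose]
        gcongr
    _ = ‖W‖ * (r ^ 2) ^ k := by ring

theorem IsSchurStable.exists_posSemidef_conj_add_eq {n : ℕ} {F W : Matrix (Fin n) (Fin n) ℝ}
    (hF : IsSchurStable F) (hW : W.PosSemidef) : ∃ S, S.PosSemidef ∧ Fᵀ * S * F + W = S := by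
  have hsum := hF.summable_transpose_pow_mul_mul_pow W
  refine ⟨∑' k, Fᵀ ^ k * W * F ^ k, ?_, ?_⟩
  · refine isClosed_setOf_posSemidef.mem_of_tendsto hsum.hasSum (.of_forall fun s => ?_)
    refine posSemidef_sum s fun k _ => ?_
    simpa only [transpose_pow] using posSemidef_conj hW (F ^ k)
  · rw [← hsum.tsum_mul_left, ← (hsum.mul_left _).tsum_mul_right, hsum.tsum_eq_zero_add, add_comm]
    simp only [pow_zero, one_mul, mul_one, pow_succ', pow_succ F, Matrix.mul_assoc]

end Stability

section LQR

open scoped MatrixOrder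

variable {n m : ℕ} {M : Matrix (Fin n) (Fin n) ℝ} {N : Matrix (Fin n) (Fin m) ℝ}
  {Q : Matrix (Fin n) (Fin n) ℝ} {R : Matrix (Fin m) (Fin m) ℝ}

theorem IsStabilizable.exists_feedbackMap_eq (h : IsStabilizable M N) (hQ : Q.PosSemidef)
    (hR : R.PosSemidef) : ∃ K S, S.PosSemidef ∧ feedbackMap M N Q R K S = S := by
  obtain ⟨K, hK⟩ := h
  obtain ⟨S, hS, hSK⟩ := hK.exists_posSemidef_conj_add_eq ((posSemidef_conj hR K).add hQ)
  exact ⟨K, S, hS, by rwa [feedbackMap, add_assoc]⟩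

theorem dareSolution_spec (hQ : Q.PosDef) (hR : R.PosDef) (h : IsStabilizable M N) :
    (dareSolution M N Q R).PosDef ∧ SolvesDARE M N Q R (dareSolution M N Q R) := by
  obtain ⟨K, S, hS, hSK⟩ := h.exists_feedbackMap_eq hQ.posSemidef hR.posSemidef
  obtain ⟨P, hP, hPR⟩ := exists_posDef_riccatiMap_eq hQ hR hS hSK.le
  exact Classical.epsilon_spec (p := fun P => P.PosDef ∧ SolvesDARE M N Q R P) ⟨P, hP, hPR.symm⟩

theorem riccatiMap_dareSolution (hQ : Q.PosDef) (hR : R.PosDef) (h : IsStabilizable M N) :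
    riccatiMap M N Q R (dareSolution M N Q R) = dareSolution M N Q R :=
  (dareSolution_spec hQ hR h).2.symm

theorem feedbackMap_lqrGain (hQ : Q.PosDef) (hR : R.PosDef) (h : IsStabilizable M N) :
    feedbackMap M N Q R (lqrGain M N Q R) (dareSolution M N Q R) = dareSolution M N Q R :=
  (feedbackMap_riccatiGain hR (dareSolution_spec hQ hR h).1.posSemidef).trans
    (riccatiMap_dareSolution hQ hR h)

end LQR

section Perturbation

open scoped MatrixOrder

variable {ι κ : Type*} [Fintype ι] [DecidableEq ι] [Fintype κ] {M M' : Matrix ι ι ℝ}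
  {N N' : Matrix ι κ ℝ} {Q P P' : Matrix ι ι ℝ} {R : Matrix κ κ ℝ} {K : Matrix κ ι ℝ} {Λ : ℝ}

theorem quadForm_closedLoop_add_le (hPK : feedbackMap M N Q R K P ≤ P) (x : EuclideanSpace ℝ ι) :
    quadForm P (toEuclideanLin (M + N * K) x) + quadForm R (toEuclideanLin K x) + quadForm Q x ≤
      quadForm P x :=
  quadForm_feedbackMap K P x ▸ quadForm_mono hPK x

theorem norm_toEuclideanLin_le_of_feedbackMap_le (hP : P.PosSemidef) (hQ : Q.PosSemidef)
    (hPK : feedbackMap M N Q R K P ≤ P) (hΛ : ∀ x, quadForm P x ≤ Λ * ‖x‖ ^ 2) {r : ℝ} (hr : 0 < r)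
    (hrR : ∀ u, r * ‖u‖ ^ 2 ≤ quadForm R u) (x : EuclideanSpace ℝ ι) :
    ‖toEuclideanLin K x‖ ≤ √(Λ / r) * ‖x‖ := by
  rw [← Real.sqrt_sq (norm_nonneg x), ← Real.sqrt_mul' _ (sq_nonneg _)]
  refine Real.le_sqrt_of_sq_le ?_
  rw [div_mul_eq_mul_div, le_div_iff₀ hr]
  linarith [quadForm_closedLoop_add_le hPK x, hrR (toEuclideanLin K x), hΛ x, quadForm_nonneg hQ x,
    quadForm_nonneg hP (toEuclideanLin (M + N * K) x)]

theorem quadForm_closedLoop_add_disturbance_le (hP : P.PosSemidef) (hQ : Q.PosSemidef)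
    (hR : R.PosSemidef) (hPK : feedbackMap M N Q R K P ≤ P) (hΛ0 : 0 < Λ)
    (hΛ : ∀ x, quadForm P x ≤ Λ * ‖x‖ ^ 2) {η : ℝ} (hη : 0 < η) (x z : EuclideanSpace ℝ ι) :
    quadForm P (toEuclideanLin (M + N * K) x + z) + quadForm R (toEuclideanLin K x) +
        quadForm Q x ≤
      quadForm P x + η * ‖x‖ ^ 2 + (1 + Λ / η) * Λ * ‖z‖ ^ 2 := by
  have decrease := quadForm_closedLoop_add_le hPK x
  set y := toEuclideanLin (M + N * K) x
  have young : quadForm P (y + z) ≤ (1 + η / Λ) * quadForm P y + (1 + Λ / η) * quadForm P z := by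
    simpa only [one_div_div] using quadForm_add_le hP (div_pos hη hΛ0) y z
  have hy : η / Λ * quadForm P y ≤ η * ‖x‖ ^ 2 :=
    calc η / Λ * quadForm P y ≤ η / Λ * (Λ * ‖x‖ ^ 2) := by
          gcongr
          linarith [hΛ x, quadForm_nonneg hQ x, quadForm_nonneg hR (toEuclideanLin K x)]
      _ = η * ‖x‖ ^ 2 := by field_simp
  have hz : (1 + Λ / η) * quadForm P z ≤ (1 + Λ / η) * Λ * ‖z‖ ^ 2 := by
    rw [mul_assoc]
    gcongr
    exact hΛ z
  linarith

/-- Inflating `P` creates a margin in the Riccati inequality, which absorbs a perturbation of the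
closed loop. -/
theorem exists_feedbackMap_smul_le (hQ : Q.PosDef) (hR : R.PosSemidef) {s : ℝ} (hs : 0 < s)
    (hΛ0 : 0 < Λ) :
    ∃ ε : ℝ, 0 < ε ∧ ∀ (M M' : Matrix ι ι ℝ) (N N' : Matrix ι κ ℝ) (K : Matrix κ ι ℝ)
      (P : Matrix ι ι ℝ), P.PosSemidef → feedbackMap M N Q R K P ≤ P →
      (∀ x, quadForm P x ≤ Λ * ‖x‖ ^ 2) →
      (∀ x, ‖toEuclideanLin (M' + N' * K) x - toEuclideanLin (M + N * K) x‖ ≤ ε * ‖x‖) →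
      feedbackMap M' N' Q R K ((1 + s) • P) ≤ (1 + s) • P := by
  obtain ⟨q, hq, hqQ⟩ := exists_mul_norm_sq_le_quadForm hQ
  obtain ⟨η, hη, hηq⟩ : ∃ η : ℝ, 0 < η ∧ (1 + s) * (2 * η) = s * q :=
    ⟨s * q / (2 * (1 + s)), by positivity, by field_simp⟩
  obtain ⟨ε, hε, hεη⟩ : ∃ ε : ℝ, 0 < ε ∧ (1 + Λ / η) * Λ * ε ^ 2 = η :=
    ⟨√(η / ((1 + Λ / η) * Λ)), by positivity, by
      rw [Real.sq_sqrt (by positivity)]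
      field_simp⟩
  refine ⟨ε, hε, fun M M' N N' K P hP hPK hΛ hMN => ?_⟩
  have hsP : ((1 + s) • P).PosSemidef := hP.smul (by positivity : 0 ≤ 1 + s)
  refine le_of_quadForm_le (posDef_feedbackMap hQ hR hsP K).posSemidef hsP fun x => ?_
  have decrease := quadForm_closedLoop_add_disturbance_le hP hQ.posSemidef hR hPK hΛ0 hΛ hη x
    (toEuclideanLin (M' + N' * K) x - toEuclideanLin (M + N * K) x)
  rw [add_sub_cancel] at decrease
  have hpert : (1 + Λ / η) * Λ *
      ‖toEuclideanLin (M' + N' * K) x - toEuclideanLin (M + N * K) x‖ ^ 2 ≤ η * ‖x‖ ^ 2 :=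
    calc _ ≤ (1 + Λ / η) * Λ * (ε * ‖x‖) ^ 2 := by
          gcongr
          exact hMN x
      _ = η * ‖x‖ ^ 2 := by rw [mul_pow, ← mul_assoc, hεη]
  have hscaled := mul_le_mul_of_nonneg_left (decrease.trans (add_le_add_right hpert _))
    (by positivity : 0 ≤ 1 + s)
  have hmargin : (1 + s) * (2 * η) * ‖x‖ ^ 2 ≤ s * quadForm Q x := by
    rw [hηq, mul_assoc]
    gcongr
    exact hqQ x
  have hRx := mul_nonneg hs.le (quadForm_nonneg hR (toEuclideanLin K x))
  rw [quadForm_feedbackMap, quadForm_smul_matrix, quadForm_smul_matrix]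
  linarith

theorem quadForm_closedLoop_add_disturbance_le_of_le_smul (hP : P.PosSemidef) (hQ : Q.PosSemidef)
    (hR : R.PosSemidef) (hPK : feedbackMap M N Q R K P ≤ P) {q : ℝ} (hq : 0 < q) (hqΛ : q ≤ Λ)
    (hqQ : ∀ x, q * ‖x‖ ^ 2 ≤ quadForm Q x) (hΛ : ∀ x, quadForm P x ≤ Λ * ‖x‖ ^ 2)
    (hP' : P' ≤ (1 + q / (4 * Λ)) • P) (x z : EuclideanSpace ℝ ι) :
    quadForm P' (toEuclideanLin (M + N * K) x + z) ≤
      quadForm P x - q / 2 * ‖x‖ ^ 2 + 2 * (1 + 4 * Λ / q) * Λ * ‖z‖ ^ 2 := by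
  have hΛ0 : 0 < Λ := hq.trans_le hqΛ
  have hswitch := quadForm_mono hP' (toEuclideanLin (M + N * K) x + z)
  rw [quadForm_smul_matrix] at hswitch
  set s := q / (4 * Λ)
  set c := (1 + 4 * Λ / q) * Λ with hc
  have hs0 : 0 ≤ 1 + s := by positivity
  have hs1 : s ≤ 1 := (div_le_one (by positivity)).2 (by linarith)
  have hsx : s * quadForm P x ≤ q / 4 * ‖x‖ ^ 2 :=
    calc s * quadForm P x ≤ s * (Λ * ‖x‖ ^ 2) := by
          gcongr
          exact hΛ x
      _ = q / 4 * ‖x‖ ^ 2 := by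
          unfold s
          field_simp
  have hsz : s * (c * ‖z‖ ^ 2) ≤ c * ‖z‖ ^ 2 := mul_le_of_le_one_left (by positivity) hs1
  have hstep : quadForm P (toEuclideanLin (M + N * K) x + z) ≤
      quadForm P x - 3 / 4 * q * ‖x‖ ^ 2 + c * ‖z‖ ^ 2 := by
    have := quadForm_closedLoop_add_disturbance_le hP hQ hR hPK hΛ0 hΛ
      (by positivity : 0 < q / 4) x z
    rw [show Λ / (q / 4) = 4 * Λ / q by field_simp, ← hc] at this
    linarith [hqQ x, quadForm_nonneg hR (toEuclideanLin K x)]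
  have hscaled := mul_le_mul_of_nonneg_left hstep hs0
  have hqx : 0 ≤ s * (q * ‖x‖ ^ 2) := by positivity
  rw [mul_assoc 2, ← hc]
  linarith

end Perturbation

section ParametrizedLQR

open scoped MatrixOrder

variable {n m p : ℕ} (A : EVec p →ᵃ[ℝ] Matrix (Fin n) (Fin n) ℝ)
  (B : EVec p →ᵃ[ℝ] Matrix (Fin n) (Fin m) ℝ)

theorem nominalStep_feedback (ϑ : EVec p) (K : Matrix (Fin m) (Fin n) ℝ) (x : EVec n) :
    nominalStep A B ϑ x (toEuclideanLin K x) = toEuclideanLin (A ϑ + B ϑ * K) x := by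
  rw [nominalStep, map_add, LinearMap.add_apply, toEuclideanLin_mul_apply]

theorem nominalStep_sub_nominalStep (ϑ ϑ' : EVec p) (x : EVec n) (u : EVec m) :
    nominalStep A B ϑ' x u - nominalStep A B ϑ x u =
      toEuclideanLin (regressor A B x u) (ϑ' - ϑ) := by
  rw [nominalStep_eq_regressor A B ϑ', nominalStep_eq_regressor A B ϑ, add_sub_add_left_eq_sub,
    map_sub]

theorem toEuclideanLin_regressor (x : EVec n) (u : EVec m) (v : EVec p) :
    toEuclideanLin (regressor A B x u) v =
      toEuclideanLin (A.linear v) x + toEuclideanLin (B.linear v) u := by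
  have h := nominalStep_sub_nominalStep A B 0 v x u
  rw [sub_zero] at h
  have hA : A.linear v = A v - A 0 := by simpa using A.linearMap_vsub v 0
  have hB : B.linear v = B v - B 0 := by simpa using B.linearMap_vsub v 0
  rw [← h, hA, hB, map_sub, map_sub, LinearMap.sub_apply, LinearMap.sub_apply, nominalStep,
    nominalStep, add_sub_add_comm]

theorem exists_norm_regressor_le {κ : ℝ} (hκ : 0 ≤ κ) :
    ∃ G : ℝ, 0 < G ∧ ∀ (x : EVec n) (u : EVec m), ‖u‖ ≤ κ * ‖x‖ →
      ∀ v, ‖toEuclideanLin (regressor A B x u) v‖ ≤ G * ‖x‖ * ‖v‖ := by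
  obtain ⟨a, ha, hA⟩ := exists_norm_toEuclideanLin_le A.linear
  obtain ⟨b, hb, hB⟩ := exists_norm_toEuclideanLin_le B.linear
  refine ⟨a + b * κ, by positivity, fun x u hu v => ?_⟩
  calc ‖toEuclideanLin (regressor A B x u) v‖
      ≤ ‖toEuclideanLin (A.linear v) x‖ + ‖toEuclideanLin (B.linear v) u‖ :=
        toEuclideanLin_regressor A B x u v ▸ norm_add_le _ _
    _ ≤ a * ‖v‖ * ‖x‖ + b * ‖v‖ * (κ * ‖x‖) := by
        gcongr
        · exact hA v x
        · exact (hB v u).trans (by gcongr)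
    _ = (a + b * κ) * ‖x‖ * ‖v‖ := by ring

variable {Q : Matrix (Fin n) (Fin n) ℝ} {R : Matrix (Fin m) (Fin m) ℝ}

theorem le_lqrLyapunov (hQ : Q.PosDef) (hR : R.PosDef) {ϑ : EVec p}
    (h : IsStabilizable (A ϑ) (B ϑ)) {q : ℝ} (hq : ∀ x : EVec n, q * ‖x‖ ^ 2 ≤ quadForm Q x)
    (x : EVec n) : q * ‖x‖ ^ 2 ≤ lqrLyapunov A B Q R x ϑ := by
  refine le_trans ?_ (quadForm_closedLoop_add_le (feedbackMap_lqrGain hQ hR h).le x)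
  linarith [hq x, quadForm_nonneg (dareSolution_spec hQ hR h).1.posSemidef
    (toEuclideanLin (A ϑ + B ϑ * lqrGain (A ϑ) (B ϑ) Q R) x),
    quadForm_nonneg hR.posSemidef (toEuclideanLin (lqrGain (A ϑ) (B ϑ) Q R) x)]

theorem exists_norm_lqrGain_le (hQ : Q.PosDef) (hR : R.PosDef) (Λ : ℝ) :
    ∃ κ : ℝ, 0 ≤ κ ∧ ∀ ϑ : EVec p, IsStabilizable (A ϑ) (B ϑ) →
      (∀ x, lqrLyapunov A B Q R x ϑ ≤ Λ * ‖x‖ ^ 2) →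
      ∀ x, ‖toEuclideanLin (lqrGain (A ϑ) (B ϑ) Q R) x‖ ≤ κ * ‖x‖ := by
  obtain ⟨r, hr, hrR⟩ := exists_mul_norm_sq_le_quadForm hR
  exact ⟨√(Λ / r), Real.sqrt_nonneg _, fun ϑ h hΛ => norm_toEuclideanLin_le_of_feedbackMap_le
    (dareSolution_spec hQ hR h).1.posSemidef hQ.posSemidef (feedbackMap_lqrGain hQ hR h).le hΛ hr
    hrR⟩

/-- The inflated solution at `ϑ` is a supersolution at `ϑ'`, under the gain of `ϑ`. -/
theorem exists_dareSolution_le_smul (hQ : Q.PosDef) (hR : R.PosDef) {s Λ : ℝ} (hs : 0 < s)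
    (hΛ0 : 0 < Λ) :
    ∃ d : ℝ, 0 < d ∧ ∀ ϑ ϑ' : EVec p, IsStabilizable (A ϑ) (B ϑ) →
      IsStabilizable (A ϑ') (B ϑ') → (∀ x, lqrLyapunov A B Q R x ϑ ≤ Λ * ‖x‖ ^ 2) →
      ‖ϑ' - ϑ‖ ≤ d →
      dareSolution (A ϑ') (B ϑ') Q R ≤ (1 + s) • dareSolution (A ϑ) (B ϑ) Q R := by
  obtain ⟨κ, hκ0, hκ⟩ := exists_norm_lqrGain_le A B hQ hR Λ
  obtain ⟨G, hG0, hG⟩ := exists_norm_regressor_le A B hκ0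
  obtain ⟨ε, hε, hsuper⟩ := exists_feedbackMap_smul_le hQ hR.posSemidef hs hΛ0
  refine ⟨ε / G, by positivity, fun ϑ ϑ' h h' hΛ hdist => ?_⟩
  have hP := (dareSolution_spec hQ hR h).1.posSemidef
  refine le_of_le_riccatiMap_of_feedbackMap_le hQ hR (dareSolution_spec hQ hR h').1.posSemidef
    (hP.smul (by positivity : 0 ≤ 1 + s)) (riccatiMap_dareSolution hQ hR h').ge
    (hsuper _ _ _ _ _ _ hP (feedbackMap_lqrGain hQ hR h).le hΛ fun x => ?_)
  rw [← nominalStep_feedback, ← nominalStep_feedback, nominalStep_sub_nominalStep]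
  calc _ ≤ G * ‖x‖ * ‖ϑ' - ϑ‖ := hG x _ (hκ ϑ h hΛ x) _
    _ ≤ G * ‖x‖ * (ε / G) := by gcongr
    _ = ε * ‖x‖ := by field_simp

theorem exists_lqrLyapunov_le_of_isCompact (hQ : Q.PosDef) (hR : R.PosDef) {Θ : Set (EVec p)}
    (hΘ : IsCompact Θ) (hstab : ∀ ϑ ∈ Θ, IsStabilizable (A ϑ) (B ϑ)) :
    ∃ Λ : ℝ, ∀ ϑ ∈ Θ, ∀ x, lqrLyapunov A B Q R x ϑ ≤ Λ * ‖x‖ ^ 2 := by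
  suffices ∃ Λ : ℝ, ∀ ϑ ∈ Θ, IsStabilizable (A ϑ) (B ϑ) →
      ∀ x, lqrLyapunov A B Q R x ϑ ≤ Λ * ‖x‖ ^ 2 from
    this.imp fun _ hΛ ϑ hϑ => hΛ ϑ hϑ (hstab ϑ hϑ)
  refine hΘ.induction_on ⟨0, by simp⟩ ?_ ?_ fun ϑ hϑ => ?_
  · rintro S T hST ⟨Λ, hΛ⟩
    exact ⟨Λ, fun ϑ hϑ => hΛ ϑ (hST hϑ)⟩
  · rintro S T ⟨Λ, hΛ⟩ ⟨Λ', hΛ'⟩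
    refine ⟨max Λ Λ', ?_⟩
    rintro ϑ (hϑ | hϑ) h x
    · exact (hΛ ϑ hϑ h x).trans (by gcongr; exact le_max_left Λ Λ')
    · exact (hΛ' ϑ hϑ h x).trans (by gcongr; exact le_max_right Λ Λ')
  · obtain ⟨Λ, hΛ0, hΛ⟩ := exists_quadForm_le_mul_norm_sq (dareSolution (A ϑ) (B ϑ) Q R)
    obtain ⟨d, hd, hcompare⟩ := exists_dareSolution_le_smul A B hQ hR one_pos hΛ0
    refine ⟨Metric.closedBall ϑ d, mem_nhdsWithin_of_mem_nhds (Metric.closedBall_mem_nhds ϑ hd),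
      (1 + 1) * Λ, fun ϑ' hϑ' h' x => ?_⟩
    calc lqrLyapunov A B Q R x ϑ'
        ≤ quadForm ((1 + 1 : ℝ) • dareSolution (A ϑ) (B ϑ) Q R) x :=
          quadForm_mono (hcompare ϑ ϑ' (hstab ϑ hϑ) h' hΛ (mem_closedBall_iff_norm.1 hϑ')) x
      _ ≤ (1 + 1) * Λ * ‖x‖ ^ 2 := by
          rw [quadForm_smul_matrix, mul_assoc]
          gcongr
          exact hΛ x

theorem lqrLyapunov_nominalStep_add_le (hQ : Q.PosDef) (hR : R.PosDef) {ϑ ϑ' : EVec p}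
    (h : IsStabilizable (A ϑ) (B ϑ)) {q Λ : ℝ} (hq : 0 < q) (hqΛ : q ≤ Λ)
    (hqQ : ∀ x : EVec n, q * ‖x‖ ^ 2 ≤ quadForm Q x)
    (hΛ : ∀ x, lqrLyapunov A B Q R x ϑ ≤ Λ * ‖x‖ ^ 2)
    (hϑ' : dareSolution (A ϑ') (B ϑ') Q R ≤ (1 + q / (4 * Λ)) • dareSolution (A ϑ) (B ϑ) Q R)
    (x z : EVec n) :
    lqrLyapunov A B Q R
        (nominalStep A B ϑ x (toEuclideanLin (lqrGain (A ϑ) (B ϑ) Q R) x) + z) ϑ' ≤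
      lqrLyapunov A B Q R x ϑ - q / 2 * ‖x‖ ^ 2 + 2 * (1 + 4 * Λ / q) * Λ * ‖z‖ ^ 2 :=
  nominalStep_feedback A B ϑ _ x ▸ quadForm_closedLoop_add_disturbance_le_of_le_smul
    (dareSolution_spec hQ hR h).1.posSemidef hQ.posSemidef hR.posSemidef
    (feedbackMap_lqrGain hQ hR h).le hq hqΛ hqQ hΛ hϑ' x z

end ParametrizedLQR

section Estimator

theorem norm_sub_sq_le_add_of_norm_sub_le {E : Type*} [SeminormedAddCommGroup E] {a b b' : E}
    {d : ℝ} (hab : ‖a - b‖ ≤ d) (hb : ‖b' - b‖ ≤ d) :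
    ‖a - b'‖ ^ 2 ≤ ‖a - b‖ ^ 2 + 3 * d * ‖b' - b‖ := by
  have triangle : ‖a - b'‖ ≤ ‖a - b‖ + ‖b' - b‖ := by
    simpa using norm_sub_le (a - b) (b' - b)
  calc ‖a - b'‖ ^ 2 ≤ (‖a - b‖ + ‖b' - b‖) ^ 2 := by gcongr
    _ = ‖a - b‖ ^ 2 + (2 * ‖a - b‖ + ‖b' - b‖) * ‖b' - b‖ := by ring
    _ ≤ ‖a - b‖ ^ 2 + 3 * d * ‖b' - b‖ := by
      gcongr
      linarith

theorem norm_add_sq_le_two_mul {E : Type*} [SeminormedAddCommGroup E] (a b : E) :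
    ‖a + b‖ ^ 2 ≤ 2 * (‖a‖ ^ 2 + ‖b‖ ^ 2) :=
  (pow_le_pow_left₀ (norm_nonneg _) (norm_add_le a b) 2).trans add_sq_le

theorem IsProjection.norm_sub_le {p : ℕ} {S : Set (EVec p)} (hS : Convex ℝ S) {y z t : EVec p}
    (h : IsProjection S y z) (ht : t ∈ S) : ‖z - t‖ ≤ ‖y - t‖ := by
  have : Nonempty S := ⟨⟨z, h.1⟩⟩
  have hmin : ‖y - z‖ = ⨅ w : S, ‖y - w‖ :=
    le_antisymm (le_ciInf fun w => by simpa only [norm_sub_rev y] using h.2 w w.2)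
      (ciInf_le ⟨0, by rintro _ ⟨w, rfl⟩; exact norm_nonneg _⟩ (⟨z, h.1⟩ : S))
  have hobtuse : inner ℝ (y - z) (t - z) ≤ 0 :=
    (norm_eq_iInf_iff_real_inner_le_zero hS h.1).1 hmin t ht
  have hsq : ‖y - t‖ ^ 2 = ‖y - z‖ ^ 2 - 2 * inner ℝ (y - z) (t - z) + ‖z - t‖ ^ 2 := by
    rw [← sub_sub_sub_cancel_right y t z, norm_sub_sq_real, norm_sub_rev t z]
  exact le_of_sq_le_sq (by linarith [sq_nonneg ‖y - z‖]) (norm_nonneg _)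

theorem norm_sq_gradientStep_le {ι κ : Type*} [Fintype ι] [DecidableEq ι] [Fintype κ]
    [DecidableEq κ] {D : Matrix κ ι ℝ} {μ G : ℝ} (hμ : 0 ≤ μ) (hG : 0 ≤ G)
    (hμG : 4 * μ * G ^ 2 ≤ 1) (hD : ∀ v, ‖toEuclideanLin D v‖ ≤ G * ‖v‖)
    (φ : EuclideanSpace ℝ ι) (w : EuclideanSpace ℝ κ) :
    ‖φ + μ • toEuclideanLin Dᵀ (w - toEuclideanLin D φ)‖ ^ 2 ≤
      ‖φ‖ ^ 2 - μ * ‖toEuclideanLin D φ‖ ^ 2 + 3 * μ * ‖w‖ ^ 2 := by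
  set y := toEuclideanLin D φ
  have expansion : ‖φ + μ • toEuclideanLin Dᵀ (w - y)‖ ^ 2 =
      ‖φ‖ ^ 2 - 2 * μ * ‖y‖ ^ 2 + 2 * μ * inner ℝ w y +
        μ ^ 2 * ‖toEuclideanLin Dᵀ (w - y)‖ ^ 2 := by
    rw [norm_add_sq_real, inner_smul_right, norm_smul, real_inner_comm,
      inner_toEuclideanLin_transpose, inner_sub_left, real_inner_self_eq_norm_sq, mul_pow,
      Real.norm_eq_abs, sq_abs]
    ring
  have quadratic : μ ^ 2 * ‖toEuclideanLin Dᵀ (w - y)‖ ^ 2 ≤ μ / 2 * (‖w‖ ^ 2 + ‖y‖ ^ 2) :=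
    calc μ ^ 2 * ‖toEuclideanLin Dᵀ (w - y)‖ ^ 2 ≤ μ ^ 2 * (G * ‖w - y‖) ^ 2 := by
          gcongr
          exact norm_toEuclideanLin_transpose_le hG hD _
      _ = μ / 4 * (4 * μ * G ^ 2) * ‖w - y‖ ^ 2 := by ring
      _ ≤ μ / 4 * 1 * (2 * (‖w‖ ^ 2 + ‖y‖ ^ 2)) := by
          gcongr
          simpa [sub_eq_add_neg] using norm_add_sq_le_two_mul w (-y)
      _ = μ / 2 * (‖w‖ ^ 2 + ‖y‖ ^ 2) := by ring
  have cross : 0 ≤ μ * ‖y - (2 : ℝ) • w‖ ^ 2 := by positivity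
  rw [norm_sub_sq_real, inner_smul_right, norm_smul, Real.norm_ofNat, real_inner_comm] at cross
  have hw : 0 ≤ μ * ‖w‖ ^ 2 := by positivity
  linarith

theorem le_add_div_of_contraction {v : ℕ → ℝ} {s b : ℝ} (hs : 0 < s) (hs1 : s ≤ 1) (hb : 0 ≤ b)
    (hv : 0 ≤ v 0) (h : ∀ k, v (k + 1) ≤ (1 - s) * v k + b) (k : ℕ) : v k ≤ v 0 + b / s := by
  induction k with
  | zero => exact le_add_of_nonneg_right (by positivity)
  | succ k ih =>
    calc v (k + 1) ≤ (1 - s) * v k + b := h k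
      _ ≤ (1 - s) * (v 0 + b / s) + b := by
          gcongr
      _ = v 0 + b / s - s * v 0 := by
          field_simp
          ring
      _ ≤ v 0 + b / s := sub_le_self _ (by positivity)

end Estimator

section AdaptiveControl

variable {n m p : ℕ} (A : EVec p →ᵃ[ℝ] Matrix (Fin n) (Fin n) ℝ)
  (B : EVec p →ᵃ[ℝ] Matrix (Fin n) (Fin m) ℝ)
  (Q : Matrix (Fin n) (Fin n) ℝ) (R : Matrix (Fin m) (Fin m) ℝ)

/-- Constants for the certainty-equivalent LQR that hold uniformly over a parameter set `Θ`: `q` and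
`Λ` bound the value function, `κ` the gain, `G` the regressor and `d` the distances in `Θ`, and `β`
weighs the perturbation of the closed loop in the decrease of the value function, which has to hold
for every change `ϑ` to `ϑ'` of the estimate. A prediction error has norm at most `G * d * ‖x‖`, so
that `small` leaves half of the decrease. -/
structure UniformLQRBounds (Θ : Set (EVec p)) (q Λ κ G d β : ℝ) : Prop where
  q_pos : 0 < q
  q_le : q ≤ Λ
  κ_nonneg : 0 ≤ κ
  G_pos : 0 < G
  β_pos : 0 < β
  le_value : ∀ ϑ ∈ Θ, ∀ x, q * ‖x‖ ^ 2 ≤ lqrLyapunov A B Q R x ϑ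
  value_le : ∀ ϑ ∈ Θ, ∀ x, lqrLyapunov A B Q R x ϑ ≤ Λ * ‖x‖ ^ 2
  gain_le : ∀ ϑ ∈ Θ, ∀ x, ‖toEuclideanLin (lqrGain (A ϑ) (B ϑ) Q R) x‖ ≤ κ * ‖x‖
  regressor_le : ∀ (x : EVec n) (u : EVec m), ‖u‖ ≤ κ * ‖x‖ →
    ∀ v, ‖toEuclideanLin (regressor A B x u) v‖ ≤ G * ‖x‖ * ‖v‖
  decrease : ∀ ϑ ∈ Θ, ∀ ϑ' ∈ Θ, ∀ x z : EVec n,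
    lqrLyapunov A B Q R
        (nominalStep A B ϑ x (toEuclideanLin (lqrGain (A ϑ) (B ϑ) Q R) x) + z) ϑ' ≤
      lqrLyapunov A B Q R x ϑ - q / 2 * ‖x‖ ^ 2 + β / 2 * ‖z‖ ^ 2
  dist_le : ∀ ϑ ∈ Θ, ∀ ϑ' ∈ Θ, ‖ϑ' - ϑ‖ ≤ d
  small : β * (G * d) ^ 2 ≤ q / 4

variable {Q R}

theorem exists_uniformLQRBounds (hQ : Q.PosDef) (hR : R.PosDef) {Θ₀ : Set (EVec p)}
    (hΘ₀ : IsCompact Θ₀) (hstab : ∀ ϑ ∈ Θ₀, IsStabilizable (A ϑ) (B ϑ)) :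
    ∃ q Λ κ G d β : ℝ, 0 < d ∧ ∀ Θ ⊆ Θ₀, Metric.diam Θ ≤ d →
      UniformLQRBounds A B Q R Θ q Λ κ G d β := by
  obtain ⟨q, hq, hqQ⟩ := exists_mul_norm_sq_le_quadForm hQ
  obtain ⟨Λ, hqΛ, hΛ⟩ : ∃ Λ, q ≤ Λ ∧ ∀ ϑ ∈ Θ₀, ∀ x, lqrLyapunov A B Q R x ϑ ≤ Λ * ‖x‖ ^ 2 := by
    obtain ⟨Λ, hΛ⟩ := exists_lqrLyapunov_le_of_isCompact A B hQ hR hΘ₀ hstab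
    exact ⟨max q Λ, le_max_left q Λ, fun ϑ hϑ x =>
      (hΛ ϑ hϑ x).trans (by gcongr; exact le_max_right q Λ)⟩
  have hΛ0 : 0 < Λ := hq.trans_le hqΛ
  obtain ⟨κ, hκ0, hκ⟩ := exists_norm_lqrGain_le A B hQ hR Λ
  obtain ⟨G, hG0, hG⟩ := exists_norm_regressor_le A B hκ0
  obtain ⟨d, hd, hcompare⟩ :=
    exists_dareSolution_le_smul A B hQ hR (by positivity : 0 < q / (4 * Λ)) hΛ0
  set β := 4 * (1 + 4 * Λ / q) * Λ with hβ
  have hβ0 : 0 < β := by positivity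
  obtain ⟨δ, hδ0, hδ⟩ : ∃ δ > 0, β * (G * δ) ^ 2 = q / 4 :=
    ⟨√(q / 4 / β) / G, by positivity, by
      rw [mul_div_cancel₀ _ hG0.ne', Real.sq_sqrt (by positivity), mul_div_cancel₀ _ hβ0.ne']⟩
  refine ⟨q, Λ, κ, G, min d δ, β, by positivity, fun Θ hΘ hdiam => ?_⟩
  have hdist : ∀ ϑ ∈ Θ, ∀ ϑ' ∈ Θ, ‖ϑ' - ϑ‖ ≤ min d δ := fun ϑ hϑ ϑ' hϑ' =>
    dist_eq_norm ϑ' ϑ ▸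
      (Metric.dist_le_diam_of_mem (hΘ₀.isBounded.subset hΘ) hϑ' hϑ).trans hdiam
  exact
    { q_pos := hq
      q_le := hqΛ
      κ_nonneg := hκ0
      G_pos := hG0
      β_pos := hβ0
      le_value := fun ϑ hϑ => le_lqrLyapunov A B hQ hR (hstab ϑ (hΘ hϑ)) hqQ
      value_le := fun ϑ hϑ => hΛ ϑ (hΘ hϑ)
      gain_le := fun ϑ hϑ => hκ ϑ (hstab ϑ (hΘ hϑ)) (hΛ ϑ (hΘ hϑ))
      regressor_le := hG
      decrease := fun ϑ hϑ ϑ' hϑ' x z => by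
        have := lqrLyapunov_nominalStep_add_le A B hQ hR (hstab ϑ (hΘ hϑ)) hq hqΛ hqQ
          (hΛ ϑ (hΘ hϑ)) (hcompare ϑ ϑ' (hstab ϑ (hΘ hϑ)) (hstab ϑ' (hΘ hϑ')) (hΛ ϑ (hΘ hϑ))
            ((hdist ϑ hϑ ϑ' hϑ').trans (min_le_left _ _))) x z
        linarith [hβ]
      dist_le := hdist
      small :=
        calc β * (G * min d δ) ^ 2 ≤ β * (G * δ) ^ 2 := by gcongr; exact min_le_right _ _
          _ = q / 4 := hδ }

variable {A B} {Θ : Set (EVec p)} {μ : ℝ} {θ θhat : ℕ → EVec p} {w x : ℕ → EVec n}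
  {u : ℕ → EVec m}

theorem IsClosedLoop.estimate_mem (h : IsClosedLoop A B Q R Θ μ θ w x u θhat) :
    ∀ k, θhat k ∈ Θ
  | 0 => h.init
  | k + 1 => (h.estimator k).1

theorem IsClosedLoop.predictionError_eq (h : IsClosedLoop A B Q R Θ μ θ w x u θhat) (k : ℕ) :
    x (k + 1) - nominalStep A B (θhat k) (x k) (u k) - w k =
      toEuclideanLin (regressor A B (x k) (u k)) (θ k - θhat k) := by
  rw [h.system k, ← nominalStep_sub_nominalStep]
  abel

namespace UniformLQRBounds

variable {q Λ κ G d β : ℝ}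

theorem norm_input_le (H : UniformLQRBounds A B Q R Θ q Λ κ G d β)
    (h : IsClosedLoop A B Q R Θ μ θ w x u θhat) (k : ℕ) : ‖u k‖ ≤ κ * ‖x k‖ :=
  h.control k ▸ H.gain_le _ (h.estimate_mem k) (x k)

theorem norm_predictionError_le (H : UniformLQRBounds A B Q R Θ q Λ κ G d β)
    (h : IsClosedLoop A B Q R Θ μ θ w x u θhat) (hθ : ∀ k, θ k ∈ Θ) (k : ℕ) :
    ‖x (k + 1) - nominalStep A B (θhat k) (x k) (u k) - w k‖ ≤ G * d * ‖x k‖ := by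
  have hG := H.G_pos
  rw [h.predictionError_eq]
  calc _ ≤ G * ‖x k‖ * ‖θ k - θhat k‖ := H.regressor_le _ _ (H.norm_input_le h k) _
    _ ≤ G * ‖x k‖ * d := by
      gcongr
      exact H.dist_le _ (h.estimate_mem k) _ (hθ k)
    _ = G * d * ‖x k‖ := by ring

theorem lqrLyapunov_sub_le (H : UniformLQRBounds A B Q R Θ q Λ κ G d β)
    (h : IsClosedLoop A B Q R Θ μ θ w x u θhat) (k : ℕ) :
    lqrLyapunov A B Q R (x (k + 1)) (θhat (k + 1)) - lqrLyapunov A B Q R (x k) (θhat k) ≤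
      -(q / 2) * ‖x k‖ ^ 2 +
        β * ‖x (k + 1) - nominalStep A B (θhat k) (x k) (u k) - w k‖ ^ 2 + β * ‖w k‖ ^ 2 := by
  set e := x (k + 1) - nominalStep A B (θhat k) (x k) (u k) - w k with he
  have hx : x (k + 1) = nominalStep A B (θhat k) (x k)
      (toEuclideanLin (lqrGain (A (θhat k)) (B (θhat k)) Q R) (x k)) + (e + w k) := by
    rw [← h.control k, he]
    abel
  have hdecrease := H.decrease _ (h.estimate_mem k) _ (h.estimate_mem (k + 1)) (x k) (e + w k)
  rw [← hx] at hdecrease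
  have hsplit := mul_le_mul_of_nonneg_left (norm_add_sq_le_two_mul e (w k)) (half_pos H.β_pos).le
  linarith

/-- Over a small parameter set, `β‖e‖²` uses up at most half of the decrease `q/2 ‖x‖²`. -/
theorem lqrLyapunov_le_contraction (H : UniformLQRBounds A B Q R Θ q Λ κ G d β)
    (h : IsClosedLoop A B Q R Θ μ θ w x u θhat) (hθ : ∀ k, θ k ∈ Θ) (k : ℕ) :
    lqrLyapunov A B Q R (x (k + 1)) (θhat (k + 1)) ≤
      (1 - q / (4 * Λ)) * lqrLyapunov A B Q R (x k) (θhat k) + β * ‖w k‖ ^ 2 := by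
  have hq := H.q_pos
  have hΛ : 0 < Λ := hq.trans_le H.q_le
  have hβ := H.β_pos
  have hdecrease := H.lqrLyapunov_sub_le h k
  have herror : β * ‖x (k + 1) - nominalStep A B (θhat k) (x k) (u k) - w k‖ ^ 2 ≤
      q / 4 * ‖x k‖ ^ 2 :=
    calc _ ≤ β * (G * d * ‖x k‖) ^ 2 := by
          gcongr
          exact H.norm_predictionError_le h hθ k
      _ = β * (G * d) ^ 2 * ‖x k‖ ^ 2 := by ring
      _ ≤ q / 4 * ‖x k‖ ^ 2 := by
          gcongr
          exact H.small
  have hvalue : q / (4 * Λ) * lqrLyapunov A B Q R (x k) (θhat k) ≤ q / 4 * ‖x k‖ ^ 2 :=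
    calc _ ≤ q / (4 * Λ) * (Λ * ‖x k‖ ^ 2) := by
          gcongr
          exact H.value_le _ (h.estimate_mem k) _
      _ = q / 4 * ‖x k‖ ^ 2 := by field_simp
  linarith

theorem norm_state_le (H : UniformLQRBounds A B Q R Θ q Λ κ G d β)
    (h : IsClosedLoop A B Q R Θ μ θ w x u θhat) (hθ : ∀ k, θ k ∈ Θ) {W r X : ℝ}
    (hw : ∀ k, ‖w k‖ ≤ W) (hx₀ : ‖x 0‖ ≤ r) (hX : 0 ≤ X)
    (hWrX : Λ * r ^ 2 + β * W ^ 2 / (q / (4 * Λ)) ≤ q * X ^ 2) (k : ℕ) : ‖x k‖ ≤ X := by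
  have hq := H.q_pos
  have hΛ : 0 < Λ := hq.trans_le H.q_le
  have hβ := H.β_pos
  have hcontraction : lqrLyapunov A B Q R (x k) (θhat k) ≤
      lqrLyapunov A B Q R (x 0) (θhat 0) + β * W ^ 2 / (q / (4 * Λ)) := by
    refine le_add_div_of_contraction (v := fun k => lqrLyapunov A B Q R (x k) (θhat k))
      (by positivity) ((div_le_one (by positivity)).2 (by linarith [H.q_le])) (by positivity)
      (le_trans (by positivity) (H.le_value _ h.init (x 0)))
      (fun k => (H.lqrLyapunov_le_contraction h hθ k).trans ?_) k
    gcongr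
    exact hw k
  refine le_of_sq_le_sq (le_of_mul_le_mul_left ?_ hq) hX
  calc q * ‖x k‖ ^ 2 ≤ lqrLyapunov A B Q R (x k) (θhat k) := H.le_value _ (h.estimate_mem k) _
    _ ≤ Λ * ‖x 0‖ ^ 2 + β * W ^ 2 / (q / (4 * Λ)) := by
      linarith [H.value_le _ h.init (x 0)]
    _ ≤ Λ * r ^ 2 + β * W ^ 2 / (q / (4 * Λ)) := by gcongr
    _ ≤ q * X ^ 2 := hWrX

theorem estimationError_sq_le (H : UniformLQRBounds A B Q R Θ q Λ κ G d β) (hconv : Convex ℝ Θ)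
    (h : IsClosedLoop A B Q R Θ μ θ w x u θhat) (hθ : ∀ k, θ k ∈ Θ) {X : ℝ} (hμ : 0 ≤ μ)
    (hμX : 4 * μ * (G * X) ^ 2 ≤ 1) {k : ℕ} (hX : ‖x k‖ ≤ X) :
    ‖θhat (k + 1) - θ (k + 1)‖ ^ 2 ≤ ‖θhat k - θ k‖ ^ 2 -
      μ * ‖x (k + 1) - nominalStep A B (θhat k) (x k) (u k) - w k‖ ^ 2 + 3 * μ * ‖w k‖ ^ 2 +
      3 * d * ‖θ (k + 1) - θ k‖ := by
  have hG := H.G_pos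
  have hX0 : 0 ≤ X := (norm_nonneg _).trans hX
  have hproj := (h.estimator k).norm_sub_le hconv (hθ k)
  have hpred := h.predictionError_eq k
  set D := regressor A B (x k) (u k)
  set e := x (k + 1) - nominalStep A B (θhat k) (x k) (u k) - w k with he
  have hinnovation : x (k + 1) - nominalStep A B (θhat k) (x k) (u k) =
      w k - toEuclideanLin D (θhat k - θ k) := by
    rw [← neg_sub (θ k), map_neg, ← hpred, he]
    abel
  have hD : ∀ v, ‖toEuclideanLin D v‖ ≤ G * X * ‖v‖ := fun v =>
    (H.regressor_le _ _ (H.norm_input_le h k) v).trans (by gcongr)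
  have hgradient := norm_sq_gradientStep_le hμ (by positivity) hμX hD (θhat k - θ k) (w k)
  rw [← norm_neg (toEuclideanLin D _), ← map_neg, neg_sub, ← hpred] at hgradient
  rw [hinnovation, add_sub_right_comm] at hproj
  have hdrift := norm_sub_sq_le_add_of_norm_sub_le (H.dist_le _ (hθ k) _ (h.estimate_mem (k + 1)))
    (H.dist_le _ (hθ k) _ (hθ (k + 1)))
  linarith [pow_le_pow_left₀ (norm_nonneg _) hproj 2]

theorem jointLyapunov_bounds (H : UniformLQRBounds A B Q R Θ q Λ κ G d β)
    (h : IsClosedLoop A B Q R Θ μ θ w x u θhat) (hμ : 0 < μ) (k : ℕ) :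
    min q (β / μ) * (‖x k‖ ^ 2 + ‖θhat k - θ k‖ ^ 2) ≤
        jointLyapunov A B Q R θ β μ (x k) (θhat k - θ k) k ∧
      jointLyapunov A B Q R θ β μ (x k) (θhat k - θ k) k ≤
        (Λ + β / μ) * (‖x k‖ ^ 2 + ‖θhat k - θ k‖ ^ 2) := by
  have hΛ : 0 < Λ := H.q_pos.trans_le H.q_le
  have hβμ : 0 < β / μ := div_pos H.β_pos hμ
  rw [jointLyapunov, sub_add_cancel, mul_add, mul_add]
  constructor
  · exact add_le_add ((mul_le_mul_of_nonneg_right (min_le_left _ _) (sq_nonneg _)).trans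
      (H.le_value _ (h.estimate_mem k) _))
      (mul_le_mul_of_nonneg_right (min_le_right _ _) (sq_nonneg _))
  · refine add_le_add ((H.value_le _ (h.estimate_mem k) _).trans ?_) ?_ <;> gcongr <;> linarith

theorem jointLyapunov_sub_le (H : UniformLQRBounds A B Q R Θ q Λ κ G d β) (hconv : Convex ℝ Θ)
    (h : IsClosedLoop A B Q R Θ μ θ w x u θhat) (hθ : ∀ k, θ k ∈ Θ) {X : ℝ} (hμ : 0 < μ)
    (hμX : 4 * μ * (G * X) ^ 2 ≤ 1) {k : ℕ} (hX : ‖x k‖ ≤ X) :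
    jointLyapunov A B Q R θ β μ (x (k + 1)) (θhat (k + 1) - θ (k + 1)) (k + 1) -
        jointLyapunov A B Q R θ β μ (x k) (θhat k - θ k) k ≤
      -(q / 2) * ‖x k‖ ^ 2 + 4 * β * ‖w k‖ ^ 2 + β / μ * (3 * d) * ‖θ (k + 1) - θ k‖ := by
  have hstate := H.lqrLyapunov_sub_le h k
  have hestimate := mul_le_mul_of_nonneg_left (H.estimationError_sq_le hconv h hθ hμ.le hμX hX)
    (div_pos H.β_pos hμ).le
  simp only [jointLyapunov, sub_add_cancel]
  set e := x (k + 1) - nominalStep A B (θhat k) (x k) (u k) - w k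
  have hweight : β / μ * (‖θhat k - θ k‖ ^ 2 - μ * ‖e‖ ^ 2 + 3 * μ * ‖w k‖ ^ 2 +
      3 * d * ‖θ (k + 1) - θ k‖) = β / μ * ‖θhat k - θ k‖ ^ 2 - β * ‖e‖ ^ 2 +
      3 * β * ‖w k‖ ^ 2 + β / μ * (3 * d) * ‖θ (k + 1) - θ k‖ := by
    field_simp
  linarith

theorem sum_norm_sq_state_le (H : UniformLQRBounds A B Q R Θ q Λ κ G d β) (hconv : Convex ℝ Θ)
    (h : IsClosedLoop A B Q R Θ μ θ w x u θhat) (hθ : ∀ k, θ k ∈ Θ) {X : ℝ} (hμ : 0 < μ)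
    (hμX : 4 * μ * (G * X) ^ 2 ≤ 1) (hX : ∀ k, ‖x k‖ ≤ X) (T : ℕ) :
    ∑ k ∈ Finset.range T, ‖x k‖ ^ 2 ≤
      (Λ + β / μ) / (q / 2) * ‖x 0‖ ^ 2 + (Λ + β / μ) / (q / 2) * ‖θhat 0 - θ 0‖ ^ 2 +
        4 * β / (q / 2) * ∑ k ∈ Finset.range T, ‖w k‖ ^ 2 +
        β / μ * (3 * d) / (q / 2) * ∑ k ∈ Finset.range T, ‖θ (k + 1) - θ k‖ := by
  have hq := H.q_pos
  have hβμ : 0 < β / μ := div_pos H.β_pos hμ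
  have hsum := sum_range_le_of_dissipation
    (v := fun k => jointLyapunov A B Q R θ β μ (x k) (θhat k - θ k) k)
    (a := fun k => q / 2 * ‖x k‖ ^ 2 - 4 * β * ‖w k‖ ^ 2 - β / μ * (3 * d) * ‖θ (k + 1) - θ k‖)
    (fun k => le_trans (by positivity) (H.jointLyapunov_bounds h hμ k).1)
    (fun k => by linarith [H.jointLyapunov_sub_le hconv h hθ hμ hμX (hX k)]) T
  simp only [Finset.sum_sub_distrib, ← Finset.mul_sum] at hsum
  refine le_of_mul_le_mul_left ?_ (half_pos hq)
  calc q / 2 * ∑ k ∈ Finset.range T, ‖x k‖ ^ 2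
      ≤ (Λ + β / μ) * (‖x 0‖ ^ 2 + ‖θhat 0 - θ 0‖ ^ 2) +
          4 * β * ∑ k ∈ Finset.range T, ‖w k‖ ^ 2 +
          β / μ * (3 * d) * ∑ k ∈ Finset.range T, ‖θ (k + 1) - θ k‖ := by
        linarith [(H.jointLyapunov_bounds h hμ 0).2]
    _ = _ := by field_simp

theorem isFiniteGainL2Stable (H : UniformLQRBounds A B Q R Θ q Λ κ G d β) (hconv : Convex ℝ Θ)
    (hθ : ∀ k, θ k ∈ Θ) {W r X : ℝ} (hμ : 0 < μ) (hμX : 4 * μ * (G * X) ^ 2 ≤ 1) (hX : 0 ≤ X)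
    (hWrX : Λ * r ^ 2 + β * W ^ 2 / (q / (4 * Λ)) ≤ q * X ^ 2) {x₀ : EVec n} (hx₀ : ‖x₀‖ ≤ r)
    (ϑ₀ : EVec p) (hΔ : Summable fun k => ‖θ (k + 1) - θ k‖) :
    IsFiniteGainL2Stable fun w x => (∀ k, ‖w k‖ ≤ W) ∧
      ∃ (u : ℕ → EVec m) (θhat : ℕ → EVec p), x 0 = x₀ ∧ θhat 0 = ϑ₀ ∧
        IsClosedLoop A B Q R Θ μ θ w x u θhat := by
  have hq := H.q_pos
  have hβ := H.β_pos
  have hΛ : 0 < Λ := hq.trans_le H.q_le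
  have hd : 0 ≤ d := (norm_nonneg _).trans (H.dist_le _ (hθ 0) _ (hθ 0))
  refine ⟨4 * β / (q / 2), (Λ + β / μ) / (q / 2) * ‖x₀‖ ^ 2 +
    (Λ + β / μ) / (q / 2) * ‖ϑ₀ - θ 0‖ ^ 2 +
    β / μ * (3 * d) / (q / 2) * ∑' k, ‖θ (k + 1) - θ k‖, by positivity, by positivity, ?_⟩
  rintro w x ⟨hw, u, θhat, rfl, rfl, h⟩ - T
  have hstate := H.norm_state_le h hθ hw hx₀ hX hWrX
  have hsum := H.sum_norm_sq_state_le hconv h hθ hμ hμX hstate (T + 1)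
  have hdrift : β / μ * (3 * d) / (q / 2) * ∑ k ∈ Finset.range (T + 1), ‖θ (k + 1) - θ k‖ ≤
      β / μ * (3 * d) / (q / 2) * ∑' k, ‖θ (k + 1) - θ k‖ := by
    gcongr
    exact hΔ.sum_le_tsum _ fun _ _ => norm_nonneg _
  linarith

end UniformLQRBounds

end AdaptiveControl

/-- The conclusions of the stability theorem for a parameter set `Θ`, disturbances of norm at most
`W`, initial states of norm at most `r` and the step size `μ`: boundedness, the Lyapunov decrease
conditions, and the `ℓ²`-bounds, with constants that do not depend on the trajectory. -/
def ClosedLoopEstimates {n m p : ℕ} (A : EVec p →ᵃ[ℝ] Matrix (Fin n) (Fin n) ℝ)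
    (B : EVec p →ᵃ[ℝ] Matrix (Fin n) (Fin m) ℝ) (Q : Matrix (Fin n) (Fin n) ℝ)
    (R : Matrix (Fin m) (Fin m) ℝ) (Θ : Set (EVec p)) (W r μ : ℝ) : Prop :=
  ∃ X U α β γ α' γ' δ' clow cup c₁ c₂ c₃ c₄ : ℝ,
    0 < X ∧ 0 < U ∧ 0 < α ∧ 0 < β ∧ 0 < γ ∧ 0 < α' ∧ 0 < γ' ∧ 0 < δ' ∧ 0 < clow ∧ 0 < cup ∧
    0 < c₁ ∧ 0 < c₂ ∧ 0 < c₃ ∧ 0 < c₄ ∧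
    (∀ (θ : ℕ → EVec p) (w x : ℕ → EVec n) (u : ℕ → EVec m) (θhat φ : ℕ → EVec p),
      (∀ k, θ k ∈ Θ) → (∀ k, ‖w k‖ ≤ W) → ‖x 0‖ ≤ r →
      IsClosedLoop A B Q R Θ μ θ w x u θhat → (∀ k, φ k = θhat k - θ k) →
      (∀ k, ‖x k‖ ≤ X ∧ ‖u k‖ ≤ U) ∧
      (∀ k, lqrLyapunov A B Q R (x (k + 1)) (θhat (k + 1)) -
          lqrLyapunov A B Q R (x k) (θhat k) ≤
        -α * ‖x k‖ ^ 2 +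
          β * ‖x (k + 1) - nominalStep A B (θhat k) (x k) (u k) - w k‖ ^ 2 +
          γ * ‖w k‖ ^ 2) ∧
      (∀ k, clow * (‖x k‖ ^ 2 + ‖φ k‖ ^ 2) ≤ jointLyapunov A B Q R θ β μ (x k) (φ k) k ∧
        jointLyapunov A B Q R θ β μ (x k) (φ k) k ≤ cup * (‖x k‖ ^ 2 + ‖φ k‖ ^ 2)) ∧
      (∀ k, jointLyapunov A B Q R θ β μ (x (k + 1)) (φ (k + 1)) (k + 1) -
          jointLyapunov A B Q R θ β μ (x k) (φ k) k ≤
        -α' * ‖x k‖ ^ 2 + γ' * ‖w k‖ ^ 2 + δ' * ‖θ (k + 1) - θ k‖) ∧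
      (∀ T : ℕ, ∑ k ∈ Finset.range (T + 1), ‖x k‖ ^ 2 ≤
        c₁ * ‖x 0‖ ^ 2 + c₂ * ‖φ 0‖ ^ 2 + c₃ * ∑ k ∈ Finset.range (T + 1), ‖w k‖ ^ 2 +
          c₄ * ∑ k ∈ Finset.range (T + 1), ‖θ (k + 1) - θ k‖)) ∧
    (∀ (θ : ℕ → EVec p) (x₀ : EVec n) (ϑ₀ : EVec p), (∀ k, θ k ∈ Θ) → ‖x₀‖ ≤ r → ϑ₀ ∈ Θ →
      Summable (fun k => ‖θ (k + 1) - θ k‖) →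
      IsFiniteGainL2Stable fun w x => (∀ k, ‖w k‖ ≤ W) ∧
        ∃ (u : ℕ → EVec m) (θhat : ℕ → EVec p), x 0 = x₀ ∧ θhat 0 = ϑ₀ ∧
          IsClosedLoop A B Q R Θ μ θ w x u θhat)

theorem UniformLQRBounds.closedLoopEstimates {n m p : ℕ}
    {A : EVec p →ᵃ[ℝ] Matrix (Fin n) (Fin n) ℝ} {B : EVec p →ᵃ[ℝ] Matrix (Fin n) (Fin m) ℝ}
    {Q : Matrix (Fin n) (Fin n) ℝ} {R : Matrix (Fin m) (Fin m) ℝ} {Θ : Set (EVec p)}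
    {q Λ κ G d β W r X μ : ℝ} (H : UniformLQRBounds A B Q R Θ q Λ κ G d β)
    (hconv : Convex ℝ Θ) (hd : 0 < d) (hX : 0 < X)
    (hWrX : Λ * r ^ 2 + β * W ^ 2 / (q / (4 * Λ)) ≤ q * X ^ 2) (hμ : 0 < μ)
    (hμX : 4 * μ * (G * X) ^ 2 ≤ 1) : ClosedLoopEstimates A B Q R Θ W r μ := by
  have hq := H.q_pos
  have hΛ : 0 < Λ := hq.trans_le H.q_le
  have hβ := H.β_pos
  have hκ := H.κ_nonneg
  refine ⟨X, κ * X + 1, q / 2, β, β, q / 2, 4 * β, β / μ * (3 * d), min q (β / μ), Λ + β / μ,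
    (Λ + β / μ) / (q / 2), (Λ + β / μ) / (q / 2), 4 * β / (q / 2), β / μ * (3 * d) / (q / 2),
    hX, by positivity, by positivity, hβ, hβ, by positivity, by positivity, by positivity,
    by positivity, by positivity, by positivity, by positivity, by positivity, by positivity,
    ?_, fun θ x₀ ϑ₀ hθ hx₀ _ => H.isFiniteGainL2Stable hconv hθ hμ hμX hX.le hWrX hx₀ ϑ₀⟩
  intro θ w x u θhat φ hθ hw hx₀ h hφ
  obtain rfl : φ = fun k => θhat k - θ k := funext hφ
  have hstate := H.norm_state_le h hθ hw hx₀ hX.le hWrX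
  have hinput : ∀ k, ‖u k‖ ≤ κ * X + 1 := fun k =>
    calc ‖u k‖ ≤ κ * ‖x k‖ := H.norm_input_le h k
      _ ≤ κ * X := by gcongr; exact hstate k
      _ ≤ κ * X + 1 := (lt_add_one _).le
  exact ⟨fun k => ⟨hstate k, hinput k⟩, H.lqrLyapunov_sub_le h, H.jointLyapunov_bounds h hμ,
    fun k => H.jointLyapunov_sub_le hconv h hθ hμ hμX (hstate k),
    fun T => H.sum_norm_sq_state_le hconv h hθ hμ hμX hstate (T + 1)⟩

theorem theorem1_general {n m p : ℕ} (A : EVec p →ᵃ[ℝ] Matrix (Fin n) (Fin n) ℝ)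
    (B : EVec p →ᵃ[ℝ] Matrix (Fin n) (Fin m) ℝ)
    (Q : Matrix (Fin n) (Fin n) ℝ) (R : Matrix (Fin m) (Fin m) ℝ) (hQ : Q.PosDef) (hR : R.PosDef)
    (Θ₀ : Set (EVec p)) (hΘ₀ : IsCompact Θ₀)
    (hstab : ∀ ϑ ∈ Θ₀, IsStabilizable (A ϑ) (B ϑ)) :
    ∃ d₀ : ℝ, 0 < d₀ ∧
      ∀ Θ : Set (EVec p), Θ ⊆ Θ₀ → Convex ℝ Θ → Metric.diam Θ ≤ d₀ →
      ∀ W r : ℝ, ∃ μ₀ : ℝ, 0 < μ₀ ∧ ∀ μ : ℝ, 0 < μ → μ ≤ μ₀ →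
        ClosedLoopEstimates A B Q R Θ W r μ := by
  obtain ⟨q, Λ, κ, G, d, β, hd, hbounds⟩ := exists_uniformLQRBounds A B hQ hR hΘ₀ hstab
  refine ⟨d, hd, fun Θ hΘ hconv hdiam W r => ?_⟩
  have H := hbounds Θ hΘ hdiam
  have hq := H.q_pos
  have hG := H.G_pos
  obtain ⟨X, hX, hWrX⟩ : ∃ X > 0, Λ * r ^ 2 + β * W ^ 2 / (q / (4 * Λ)) ≤ q * X ^ 2 :=
    ((Filter.eventually_gt_atTop 0).and (((Filter.tendsto_pow_atTop two_ne_zero).const_mul_atTop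
      hq).eventually_ge_atTop _)).exists
  refine ⟨1 / (4 * (G * X) ^ 2), by positivity, fun μ hμ hμ₀ =>
    H.closedLoopEstimates hconv hd hX hWrX hμ ?_⟩
  rw [le_div_iff₀ (by positivity)] at hμ₀
  linarith

theorem theorem1 {n m p : ℕ} (A : EVec p →ᵃ[ℝ] Matrix (Fin n) (Fin n) ℝ)
    (B : EVec p →ᵃ[ℝ] Matrix (Fin n) (Fin m) ℝ)
    (Q : Matrix (Fin n) (Fin n) ℝ) (R : Matrix (Fin m) (Fin m) ℝ) (hQ : Q.PosDef) (hR : R.PosDef)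
    (Θ₀ : Set (EVec p)) (hΘ₀ : IsCompact Θ₀)
    (hstab : ∀ ϑ ∈ Θ₀, IsStabilizable (A ϑ) (B ϑ)) :
    ∃ d₀ : ℝ, 0 < d₀ ∧
      ∀ Θ : Set (EVec p), Θ ⊆ Θ₀ → IsCompact Θ → Convex ℝ Θ → Metric.diam Θ ≤ d₀ →
      ∀ W r : ℝ, 0 ≤ W → 0 ≤ r →
      ∃ μ₀ : ℝ, 0 < μ₀ ∧ ∀ μ : ℝ, 0 < μ → μ ≤ μ₀ →
        ∃ X U α β γ α' γ' δ' clow cup c₁ c₂ c₃ c₄ : ℝ,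
          0 < X ∧ 0 < U ∧ 0 < α ∧ 0 < β ∧ 0 < γ ∧ 0 < α' ∧ 0 < γ' ∧ 0 < δ' ∧ 0 < clow ∧ 0 < cup ∧
          0 < c₁ ∧ 0 < c₂ ∧ 0 < c₃ ∧ 0 < c₄ ∧
          -- the three properties, along every closed-loop trajectory
          (∀ (θ : ℕ → EVec p) (w x : ℕ → EVec n) (u : ℕ → EVec m) (θhat φ : ℕ → EVec p),
            (∀ k, θ k ∈ Θ) → (∀ k, ‖w k‖ ≤ W) → ‖x 0‖ ≤ r →
            IsClosedLoop A B Q R Θ μ θ w x u θhat → (∀ k, φ k = θhat k - θ k) →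
            -- (a) boundedness of state and input
            (∀ k, ‖x k‖ ≤ X ∧ ‖u k‖ ≤ U) ∧
            -- the weight `β` of the joint Lyapunov function comes from the LQR decrease condition
            (∀ k, lqrLyapunov A B Q R (x (k + 1)) (θhat (k + 1)) -
                lqrLyapunov A B Q R (x k) (θhat k) ≤
              -α * ‖x k‖ ^ 2 +
                β * ‖x (k + 1) - nominalStep A B (θhat k) (x k) (u k) - w k‖ ^ 2 +
                γ * ‖w k‖ ^ 2) ∧
            -- (b) quadratic bounds and decrease of the joint Lyapunov function
            (∀ k, clow * (‖x k‖ ^ 2 + ‖φ k‖ ^ 2) ≤ jointLyapunov A B Q R θ β μ (x k) (φ k) k ∧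
              jointLyapunov A B Q R θ β μ (x k) (φ k) k ≤ cup * (‖x k‖ ^ 2 + ‖φ k‖ ^ 2)) ∧
            (∀ k, jointLyapunov A B Q R θ β μ (x (k + 1)) (φ (k + 1)) (k + 1) -
                jointLyapunov A B Q R θ β μ (x k) (φ k) k ≤
              -α' * ‖x k‖ ^ 2 + γ' * ‖w k‖ ^ 2 + δ' * ‖θ (k + 1) - θ k‖) ∧
            -- (c) the cumulative bound on the state
            (∀ T : ℕ, ∑ k ∈ Finset.range (T + 1), ‖x k‖ ^ 2 ≤
              c₁ * ‖x 0‖ ^ 2 + c₂ * ‖φ 0‖ ^ 2 + c₃ * ∑ k ∈ Finset.range (T + 1), ‖w k‖ ^ 2 +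
                c₄ * ∑ k ∈ Finset.range (T + 1), ‖θ (k + 1) - θ k‖)) ∧
          -- finite-gain stability when the parameter variation is summable
          (∀ (θ : ℕ → EVec p) (x₀ : EVec n) (ϑ₀ : EVec p), (∀ k, θ k ∈ Θ) → ‖x₀‖ ≤ r → ϑ₀ ∈ Θ →
            Summable (fun k => ‖θ (k + 1) - θ k‖) →
            IsFiniteGainL2Stable fun w x => (∀ k, ‖w k‖ ≤ W) ∧
              ∃ (u : ℕ → EVec m) (θhat : ℕ → EVec p), x 0 = x₀ ∧ θhat 0 = ϑ₀ ∧
                IsClosedLoop A B Q R Θ μ θ w x u θhat) := by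
  obtain ⟨d₀, hd₀, h⟩ := theorem1_general A B Q R hQ hR Θ₀ hΘ₀ hstab
  exact ⟨d₀, hd₀, fun Θ hΘ _ hconv hdiam W r _ _ => h Θ hΘ hconv hdiam W r⟩
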